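/- Let $\mathcal H=\mathbb C^d$ with $d\ge 1$, let $N,M\ge 1$ be integers, and let $d\psi$ be the uniform probability measure on pure states of $\mathcal H$ (induced by the Haar measure of $U(d)$). Write $\psi=|\psi\rangle\langle\psi|$. An $N\to M$ quantum cloning machine (QCM) is a completely positive trace-preserving map $\mathcal L:\mathcal B(\mathcal H^{\otimes N})\to\mathcal B(\mathcal H^{\otimes M})$; its average fidelity is $$\mathcal F_{\rm QCM}=\sum_{k=1}^M\int\frac1M\langle\psi|\,\mathrm{tr}_{\bar k}\,\mathcal L(\psi^{\otimes N})\,|\psi\rangle\,d\psi ,$$ where $\mathrm{tr}_{\bar k}$ is the trace over all tensor factors but the $k$-th. It is universal (a UQCM) if for every pure state $\psi$ the output $\mathcal L(\psi^{\otimes N})$ is supported on the symmetric subspace and the fidelity $\langle\psi|\mathrm{tr}_{\bar k}\mathcal L(\psi^{\otimes N})|\psi\rangle$ depends neither on $k$ nor on $\psi$. A challenge-estimation (measure-and-prepare) attack consists of a POVM $\{M_j\}$ on $\mathcal H^{\otimes N}$ with countably many outcomes and pure guesses $|\psi_j\rangle$; its average fidelity is $$\mathcal F_{\rm est}=\sum_j\int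 \mathrm{tr}(M_j\psi^{\otimes N})\,|\langle\psi_j|\psi\rangle|^2\,d\psi .$$ Let $\mathcal F^{\rm opt}_{\rm QCM}(N,M)$, $\mathcal F^{\rm opt}_{\rm UQCM}(N,M)$ and $\mathcal F^{\rm opt}_{\rm est}(N)$ be the suprema of these average fidelities over all QCMs, all UQCMs and all challenge-estimation attacks, respectively. Then the optimal quantum cloning attack is superior to the optimal challenge-estimation attack: $$\mathcal F^{\rm opt}_{\rm QCM}(N,M)\ge\mathcal F^{\rm opt}_{\rm est}(N),\qquad \mathcal F^{\rm opt}_{\rm UQCM}(N,M)\ge\mathcal F^{\rm opt}_{\rm est}(N),$$ and both inequalities are strict if $d>1$. Moreover $\mathcal F^{\rm opt}_{\rm est}(N)=\frac{N+1}{N+d}$; if $N\le M$, then $$\mathcal F^{\rm opt}_{\rm QCM}(N,M)=\mathcal F^{\rm opt}_{\rm UQCM}(N,M)=\frac{M-N+N(M+d)}{M(N+d)};$$ and if $d>1$, then $$\frac{M-N+N(M+d)}{M(N+d)}>\frac{N+1}{N+d}.$$ -/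

import Mathlib

open MeasureTheory
open scoped Matrix ComplexConjugate Matrix.Norms.L2Operator MatrixOrder ComplexOrder

noncomputable section

namespace QuantumCloning

/-! ### Pure states and their uniform distribution

The one-particle Hilbert space is `ℂ^d`. -/

/-- A vector of `ℂ^d` that describes a pure state. -/
def IsUnitVector {d : ℕ} (ψ : Fin d → ℂ) : Prop := star ψ ⬝ᵥ ψ = 1

instance instMeasurableSpaceUnitaryGroup (d : ℕ) :
    MeasurableSpace (Matrix.unitaryGroup (Fin d) ℂ) := borel _

instance instBorelSpaceUnitaryGroup (d : ℕ) :
    BorelSpace (Matrix.unitaryGroup (Fin d) ℂ) := ⟨rfl⟩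

instance instCompactSpaceUnitaryGroup (d : ℕ) :
    CompactSpace (Matrix.unitaryGroup (Fin d) ℂ) := by
  have hclosed : IsClosed (Matrix.unitaryGroup (Fin d) ℂ : Set (Matrix (Fin d) (Fin d) ℂ)) := by
    have : (Matrix.unitaryGroup (Fin d) ℂ : Set (Matrix (Fin d) (Fin d) ℂ))
        = {U | U * star U = 1} := by
      ext U
      exact Matrix.mem_unitaryGroup_iff
    rw [this]
    exact isClosed_eq (continuous_id.mul continuous_star) continuous_const
  have hK : IsCompact (Set.univ.pi fun _ : Fin d => Set.univ.pi fun _ : Fin d =>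
      Metric.closedBall (0 : ℂ) 1) :=
    isCompact_univ_pi fun _ => isCompact_univ_pi fun _ => isCompact_closedBall _ _
  refine isCompact_iff_compactSpace.mp (IsCompact.of_isClosed_subset hK hclosed ?_)
  intro U hU i _ j _
  simpa using entry_norm_bound_of_unitary hU i j

/-- The normalized Haar measure of `U(d)`. -/
def haarUnitary (d : ℕ) : Measure (Matrix.unitaryGroup (Fin d) ℂ) := Measure.haarMeasure ⊤

/-- The uniform distribution `dψ` of pure states: the law of `U e₀` for a Haar random unitary `U`.
(States are represented by unit vectors; only functions of the projector `|ψ⟩⟨ψ|` are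
integrated below.) -/
def pureStateMeasure (d : ℕ) [NeZero d] : Measure (Fin d → ℂ) :=
  (haarUnitary d).map
    fun U : Matrix.unitaryGroup (Fin d) ℂ => (U : Matrix (Fin d) (Fin d) ℂ) *ᵥ Pi.single 0 1

/-! ### Operators on `(ℂ^d)^{⊗n}` -/

/-- `B((ℂ^d)^{⊗n})`: matrices indexed by words of length `n`, that is, by the product basis. -/
abbrev Op (d n : ℕ) : Type := Matrix (Fin n → Fin d) (Fin n → Fin d) ℂ

/-- `(|ψ⟩⟨ψ|)^{⊗n}`. -/
def copies {d : ℕ} (n : ℕ) (ψ : Fin d → ℂ) : Op d n :=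
  Matrix.of fun x y => ∏ i, ψ (x i) * conj (ψ (y i))

/-- The partial trace over all tensor factors except the `k`-th. -/
def reduced {d n : ℕ} (k : Fin n) (ρ : Op d n) : Matrix (Fin d) (Fin d) ℂ :=
  Matrix.of fun a b => ∑ x : Fin n → Fin d, if x k = a then ρ x (Function.update x k b) else 0

/-- `⟨ψ|σ|ψ⟩`, which is real for Hermitian `σ`. -/
def expect {d : ℕ} (ψ : Fin d → ℂ) (σ : Matrix (Fin d) (Fin d) ℂ) : ℝ :=
  (star ψ ⬝ᵥ (σ *ᵥ ψ)).re

/-- The range of `ρ` lies in the symmetric subspace of `(ℂ^d)^{⊗n}`: every column of `ρ`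
is a permutation invariant tensor. -/
def SymmetricSupport {d n : ℕ} (ρ : Op d n) : Prop :=
  ∀ (σ : Equiv.Perm (Fin n)) (x y : Fin n → Fin d), ρ (x ∘ σ) y = ρ x y

/-! ### Cloning machines -/

/-- An `N → M` quantum cloning machine: a completely positive, trace preserving map
`B((ℂ^d)^{⊗N}) → B((ℂ^d)^{⊗M})`. -/
structure QCM (d N M : ℕ) where
  toMap : CompletelyPositiveMap (Op d N) (Op d M)
  trace_map : ∀ ρ : Op d N, (toMap ρ).trace = ρ.trace

/-- The fidelity of the `k`-th clone when the input is `N` copies of `ψ`. -/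
def QCM.cloneFidelity {d N M : ℕ} (L : QCM d N M) (k : Fin M) (ψ : Fin d → ℂ) : ℝ :=
  expect ψ (reduced k (L.toMap (copies N ψ)))

/-- The average single-copy fidelity
`∑ₖ ∫ (1/M) ⟨ψ| tr_{k̄} L(ψ^{⊗N}) |ψ⟩ dψ`. -/
def QCM.fidelity {d N M : ℕ} [NeZero d] (L : QCM d N M) : ℝ :=
  ∑ k : Fin M, ∫ ψ, (1 / (M : ℝ)) * L.cloneFidelity k ψ ∂(pureStateMeasure d)

/-- Universal cloning machines: on `N` copies of a pure state the output is supported on the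
symmetric subspace (so all clones are in the same state), and the fidelity of the clones
does not depend on the input state. -/
def QCM.IsUniversal {d N M : ℕ} (L : QCM d N M) : Prop :=
  (∀ ψ : Fin d → ℂ, IsUnitVector ψ → SymmetricSupport (L.toMap (copies N ψ))) ∧
  ∃ f : ℝ, ∀ ψ : Fin d → ℂ, IsUnitVector ψ → ∀ k : Fin M, L.cloneFidelity k ψ = f

/-- The optimal average fidelity of `N → M` quantum cloning machines. -/
def optQCM (d N M : ℕ) [NeZero d] : ℝ :=
  sSup (Set.range fun L : QCM d N M => L.fidelity)

/-- The optimal average fidelity of universal `N → M` quantum cloning machines. -/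
def optUQCM (d N M : ℕ) [NeZero d] : ℝ :=
  sSup {f : ℝ | ∃ L : QCM d N M, L.IsUniversal ∧ L.fidelity = f}

/-! ### Challenge estimation (measure and prepare) -/

/-- A challenge-estimation strategy: a measurement (POVM) with effects `effect j` on all `N`
particles together, and a pure state `guess j` prepared after outcome `j`. There may be countably
many outcomes; finitely many are included through zero effects. -/
structure Estimation (d N : ℕ) where
  effect : ℕ → Op d N
  effect_posSemidef : ∀ j, (effect j).PosSemidef
  effect_sum : HasSum effect 1
  guess : ℕ → Fin d → ℂ
  guess_unit : ∀ j, IsUnitVector (guess j)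

/-- The average fidelity `∑ⱼ ∫ tr(Mⱼ ψ^{⊗N}) |⟨ψⱼ|ψ⟩|² dψ`. -/
def Estimation.fidelity {d N : ℕ} [NeZero d] (E : Estimation d N) : ℝ :=
  ∑' j, ∫ ψ, (E.effect j * copies N ψ).trace.re * ‖star (E.guess j) ⬝ᵥ ψ‖ ^ 2
    ∂(pureStateMeasure d)

/-- The optimal average fidelity of challenge estimation from `N` copies. -/
def optEst (d N : ℕ) [NeZero d] : ℝ :=
  sSup (Set.range fun E : Estimation d N => E.fidelity)

end QuantumCloning

end

/-!
All averages over the Haar measure enter through the moment operators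
`μₙ = ∫ (|ψ⟩⟨ψ|)^{⊗n} dψ` (`moment`). Differentiating the invariance `U^{⊗n} μₙ = μₙ U^{⊗n}` along
`U = exp(tX)` shows that `μₙ` commutes with the collective operators `∑ᵢ Xᵢ`
(`collective_mul_moment`). Written out for matrix units and summed over one index, this is a
recursion that expresses `μₙ₊₁` through `μₙ` (`moment_succ`), in which a coordinate `ψ̄ₐ` acts like
a derivative. The recursion replaces the representation theory of the symmetric subspace: it shows
that `μₙ` acts on symmetric tensors as the scalar `mₙ = ∏ₖ (k+1)/(k+d)` (`moment_mulVec`), so that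
`μₙ / mₙ` is the projector onto the symmetric subspace.

*Estimation.* By the recursion, `∫ ψ^{⊗n} |⟨φ|ψ⟩|² dψ = μₙ (1 + ∑ᵢ |φ⟩⟨φ|ᵢ) / (n + d)`. The two
factors commute and the second is at most `n + 1`, hence every guess gains at most the factor
`(n+1)/(n+d)` (`weightedMoment_le`, `Estimation.fidelity_le`). Conversely `μₙ` lies in the closed
convex hull of the product states, and a finite convex combination close to `μₙ` gives a measurement
that almost attains the bound (`exists_estimation_fidelity_ge`).

*Cloning, upper bound.* The fidelity of a machine is linear in its Choi matrix, which is positive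
semidefinite (`exists_choi`). By the recursion, the coefficient operator is
`(μ_N ⊗ 1)(1 + (1/M) ∑_{j,k} C_{jk}) / (N + d)`, where `C_{jk} = |Ω⟩⟨Ω|` contracts the input
factor `j` with the output factor `k`. The operators `C_{jk}` for a fixed `j` satisfy the relations
`C_k² = d C_k` and `C_k C_l = C_k s_{kl}` with the exchange `s_{kl}` of two outputs; they give
`S² ≤ (M + d - 1) S` for `S = ∑ₖ C_{jk}`, thus `S ≤ M + d - 1` (`sum_contraction_le`). Since
`μ_N ⊗ 1` commutes with `∑ⱼ C_{jk}`, the fidelity is at most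
`(1 + N (M + d - 1) / M) / (N + d)` (`QCM.fidelity_le`).

*Cloning, attainability.* For `N ≤ M` the machine `ρ ↦ (m_M / m_N) P (ρ ⊗ 1) P`, with the projector
`P = μ_M / m_M`, is universal and attains the bound (`exists_universal_cloningValue`). For `M ≤ N`
discarding particles is universal with fidelity `1` (`exists_universal_of_le`), which is at least
the estimation bound.
-/

namespace QuantumCloning

/-! ### Integration over pure states -/

section Haar

variable {d : ℕ}

lemma continuous_unitary_mulVec (v : Fin d → ℂ) :
    Continuous fun U : Matrix.unitaryGroup (Fin d) ℂ => (U : Matrix (Fin d) (Fin d) ℂ) *ᵥ v :=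
  Continuous.matrix_mulVec continuous_subtype_val continuous_const

lemma isUnitVector_unitary_mulVec (U : Matrix.unitaryGroup (Fin d) ℂ) {v : Fin d → ℂ}
    (hv : IsUnitVector v) : IsUnitVector ((U : Matrix (Fin d) (Fin d) ℂ) *ᵥ v) := by
  have h : (U : Matrix (Fin d) (Fin d) ℂ)ᴴ * U = 1 := Matrix.mem_unitaryGroup_iff'.mp U.2
  unfold IsUnitVector at *
  rw [Matrix.star_mulVec, Matrix.dotProduct_mulVec, Matrix.vecMul_vecMul, h, Matrix.vecMul_one, hv]

lemma isUnitVector_single (i : Fin d) : IsUnitVector (Pi.single i 1 : Fin d → ℂ) := by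
  simp [IsUnitVector]

instance instIsProbabilityMeasureHaarUnitary : IsProbabilityMeasure (haarUnitary d) :=
  ⟨Measure.haarMeasure_self⟩

instance instIsMulLeftInvariantHaarUnitary : (haarUnitary d).IsMulLeftInvariant := by
  unfold haarUnitary; infer_instance

variable [NeZero d]

instance instIsProbabilityMeasurePureStateMeasure : IsProbabilityMeasure (pureStateMeasure d) :=
  Measure.isProbabilityMeasure_map (continuous_unitary_mulVec _).measurable.aemeasurable

lemma ae_isUnitVector : ∀ᵐ ψ ∂pureStateMeasure d, IsUnitVector ψ := by
  have hm : MeasurableSet {ψ : Fin d → ℂ | IsUnitVector ψ} :=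
    (isClosed_eq (by fun_prop) continuous_const).measurableSet
  rw [pureStateMeasure, ae_map_iff (continuous_unitary_mulVec _).measurable.aemeasurable hm]
  exact .of_forall fun U => isUnitVector_unitary_mulVec U (isUnitVector_single 0)

lemma integrable_of_continuous {E : Type*} [NormedAddCommGroup E]
    {f : (Fin d → ℂ) → E} (hf : Continuous f) : Integrable f (pureStateMeasure d) := by
  rw [pureStateMeasure, integrable_map_measure hf.aestronglyMeasurable
    (continuous_unitary_mulVec _).measurable.aemeasurable]
  exact (hf.comp (continuous_unitary_mulVec _)).integrable_of_hasCompactSupport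
    (HasCompactSupport.of_compactSpace _)

lemma integral_unitary_mulVec {E : Type*} [NormedAddCommGroup E] [NormedSpace ℝ E]
    {f : (Fin d → ℂ) → E} (hf : Continuous f)
    (V : Matrix.unitaryGroup (Fin d) ℂ) :
    ∫ ψ, f ((V : Matrix (Fin d) (Fin d) ℂ) *ᵥ ψ) ∂pureStateMeasure d
      = ∫ ψ, f ψ ∂pureStateMeasure d := by
  have hV : Continuous fun ψ : Fin d → ℂ => f ((V : Matrix (Fin d) (Fin d) ℂ) *ᵥ ψ) :=
    hf.comp (by fun_prop)
  rw [pureStateMeasure, integral_map (continuous_unitary_mulVec _).measurable.aemeasurable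
    hV.aestronglyMeasurable, integral_map (continuous_unitary_mulVec _).measurable.aemeasurable
    hf.aestronglyMeasurable]
  refine Eq.trans ?_ (integral_mul_left_eq_self
    (fun U : Matrix.unitaryGroup (Fin d) ℂ =>
      f ((U : Matrix (Fin d) (Fin d) ℂ) *ᵥ Pi.single 0 1)) V)
  simp only [Matrix.mulVec_mulVec, Submonoid.coe_mul]

end Haar

/-! ### Product operators -/

section Tensor

variable {d n : ℕ}

/-- The product operator `A₀ ⊗ A₁ ⊗ ⋯` on `(ℂ^d)^{⊗n}`. -/
def tensorOp (A : Fin n → Matrix (Fin d) (Fin d) ℂ) : Op d n :=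
  Matrix.of fun x y => ∏ i, A i (x i) (y i)

lemma tensorOp_apply (A : Fin n → Matrix (Fin d) (Fin d) ℂ) (x y : Fin n → Fin d) :
    tensorOp A x y = ∏ i, A i (x i) (y i) := rfl

lemma tensorOp_mul (A B : Fin n → Matrix (Fin d) (Fin d) ℂ) :
    tensorOp A * tensorOp B = tensorOp fun i => A i * B i := by
  ext x y
  simp only [Matrix.mul_apply, tensorOp_apply, ← Finset.prod_mul_distrib, Finset.prod_univ_sum,
    Fintype.piFinset_univ]

lemma trace_tensorOp (A : Fin n → Matrix (Fin d) (Fin d) ℂ) :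
    (tensorOp A).trace = ∏ i, (A i).trace := by
  simp only [Matrix.trace, Matrix.diag, tensorOp_apply, Finset.prod_univ_sum,
    Fintype.piFinset_univ]

lemma conjTranspose_tensorOp (A : Fin n → Matrix (Fin d) (Fin d) ℂ) :
    (tensorOp A)ᴴ = tensorOp fun i => (A i)ᴴ := by
  ext x y
  simp [tensorOp_apply, Matrix.conjTranspose_apply]

lemma tensorOp_one : tensorOp (fun _ : Fin n => (1 : Matrix (Fin d) (Fin d) ℂ)) = 1 := by
  ext x y
  simp only [tensorOp_apply, Matrix.one_apply, Finset.prod_ite_zero, Finset.prod_const_one,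
    Finset.mem_univ, true_imp_iff, funext_iff]

/-- The projector `|ψ⟩⟨ψ|` (for a unit vector `ψ`). -/
def proj (ψ : Fin d → ℂ) : Matrix (Fin d) (Fin d) ℂ := Matrix.vecMulVec ψ (star ψ)

lemma copies_eq_tensorOp (ψ : Fin d → ℂ) : copies n ψ = tensorOp fun _ => proj ψ := rfl

lemma copies_apply (ψ : Fin d → ℂ) (x y : Fin n → Fin d) :
    copies n ψ x y = ∏ i, ψ (x i) * conj (ψ (y i)) := rfl

lemma trace_proj_mul_proj (φ ψ : Fin d → ℂ) :
    (proj φ * proj ψ).trace = ((‖star φ ⬝ᵥ ψ‖ ^ 2 : ℝ) : ℂ) := by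
  have h : star ψ ⬝ᵥ φ = conj (star φ ⬝ᵥ ψ) := by
    rw [starRingEnd_apply, ← Matrix.star_dotProduct]
  rw [proj, proj, Matrix.vecMulVec_mul_vecMulVec, Matrix.trace_vecMulVec, dotProduct_smul,
    smul_eq_mul,
    dotProduct_comm φ, h, Complex.mul_conj, Complex.normSq_eq_norm_sq]

lemma proj_mul_proj {ψ : Fin d → ℂ} (h : IsUnitVector ψ) : proj ψ * proj ψ = proj ψ := by
  rw [proj, Matrix.vecMulVec_mul_vecMulVec, h, one_smul]

lemma trace_proj {ψ : Fin d → ℂ} (h : IsUnitVector ψ) : (proj ψ).trace = 1 := by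
  rw [proj, Matrix.trace_vecMulVec, dotProduct_comm, h]

lemma conjTranspose_proj (ψ : Fin d → ℂ) : (proj ψ)ᴴ = proj ψ := by
  rw [proj, Matrix.conjTranspose_vecMulVec, star_star]

/-- `X` acting on the `i`-th tensor factor. -/
def site (i : Fin n) (X : Matrix (Fin d) (Fin d) ℂ) : Op d n :=
  tensorOp (Function.update (fun _ => 1) i X)

lemma site_apply (i : Fin n) (X : Matrix (Fin d) (Fin d) ℂ) (x y : Fin n → Fin d) :
    site i X x y = X (x i) (y i)
      * ∏ j ∈ Finset.univ.erase i, (1 : Matrix (Fin d) (Fin d) ℂ) (x j) (y j) := by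
  rw [site, tensorOp_apply, ← Finset.mul_prod_erase _ _ (Finset.mem_univ i)]
  congr 1
  · simp
  · refine Finset.prod_congr rfl fun j hj => ?_
    rw [Function.update_of_ne (Finset.ne_of_mem_erase hj)]

lemma site_apply_eq_sum (i : Fin n) (X : Matrix (Fin d) (Fin d) ℂ) (x y : Fin n → Fin d) :
    site i X x y = ∑ a, if x = Function.update y i a then X a (y i) else 0 := by
  rw [site_apply]
  simp only [Matrix.one_apply, Finset.prod_ite_zero, Finset.prod_const_one, Finset.mem_erase,
    Finset.mem_univ, and_true]
  by_cases h : ∀ j, j ≠ i → x j = y j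
  · have hx : x = Function.update y i (x i) := by
      ext j; by_cases hj : j = i
      · subst hj; simp
      · simp [hj, h j hj]
    rw [if_pos h, mul_one, Finset.sum_eq_single (x i)]
    · rw [if_pos hx]
    · intro a _ ha
      rw [if_neg]
      rintro rfl
      simp at ha
    · simp
  · rw [if_neg h, mul_zero, Finset.sum_eq_zero]
    intro a _
    rw [if_neg]
    rintro rfl
    exact h fun j hj => by simp [hj]

lemma mul_site_apply {ι : Type*} (A : Matrix ι (Fin n → Fin d) ℂ) (i : Fin n)
    (X : Matrix (Fin d) (Fin d) ℂ) (x : ι) (y : Fin n → Fin d) :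
    (A * site i X) x y = ∑ a, A x (Function.update y i a) * X a (y i) := by
  simp only [Matrix.mul_apply, site_apply_eq_sum, Finset.mul_sum]
  rw [Finset.sum_comm]
  simp

lemma site_mul_site (i : Fin n) (X Y : Matrix (Fin d) (Fin d) ℂ) :
    site i X * site i Y = site i (X * Y) := by
  rw [site, site, site, tensorOp_mul]
  congr 1
  ext j : 1
  by_cases h : j = i
  · subst h; simp
  · simp [h]

lemma conjTranspose_site (i : Fin n) (X : Matrix (Fin d) (Fin d) ℂ) :
    (site i X)ᴴ = site i Xᴴ := by
  rw [site, site, conjTranspose_tensorOp]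
  congr 1
  ext j : 1
  by_cases h : j = i
  · subst h; simp
  · simp [h]

lemma site_mul_apply {ι : Type*} (A : Matrix (Fin n → Fin d) ι ℂ) (i : Fin n)
    (X : Matrix (Fin d) (Fin d) ℂ) (x : Fin n → Fin d) (y : ι) :
    (site i X * A) x y = ∑ a, X (x i) a * A (Function.update x i a) y := by
  have h := mul_site_apply Aᴴ i Xᴴ y x
  rw [← conjTranspose_site, ← Matrix.conjTranspose_mul, Matrix.conjTranspose_apply] at h
  have h2 := congrArg star h
  simpa [mul_comm] using h2

/-- The collective operator `∑ᵢ Xᵢ`, the derivative of `U^{⊗n}` at `1` in the direction `X`. -/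
def collective (n : ℕ) (X : Matrix (Fin d) (Fin d) ℂ) : Op d n := ∑ i : Fin n, site i X

lemma site_add (i : Fin n) (X Y : Matrix (Fin d) (Fin d) ℂ) :
    site i (X + Y) = site i X + site i Y := by
  ext x y
  simp [site_apply, add_mul]

lemma site_smul (i : Fin n) (c : ℂ) (X : Matrix (Fin d) (Fin d) ℂ) :
    site i (c • X) = c • site i X := by
  ext x y
  simp [site_apply, mul_assoc]

lemma collective_add (X Y : Matrix (Fin d) (Fin d) ℂ) :
    collective n (X + Y) = collective n X + collective n Y := by
  simp [collective, site_add, Finset.sum_add_distrib]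

lemma collective_smul (c : ℂ) (X : Matrix (Fin d) (Fin d) ℂ) :
    collective n (c • X) = c • collective n X := by
  simp [collective, site_smul, Finset.smul_sum]

lemma continuous_copies : Continuous (copies n : (Fin d → ℂ) → Op d n) := by
  refine continuous_matrix fun x y => ?_
  simp only [copies_apply]
  fun_prop

lemma copies_mulVec (U : Matrix (Fin d) (Fin d) ℂ) (ψ : Fin d → ℂ) :
    copies n (U *ᵥ ψ) = tensorOp (fun _ => U) * copies n ψ * (tensorOp fun _ => U)ᴴ := by
  rw [copies_eq_tensorOp, copies_eq_tensorOp, conjTranspose_tensorOp, tensorOp_mul, tensorOp_mul]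
  congr 1
  ext1 _
  rw [proj, proj, Matrix.mul_vecMulVec, Matrix.vecMulVec_mul, Matrix.star_mulVec]

/-- The derivative of `exp(tX)^{⊗n}` at `t = 0` is the collective operator of `X`. -/
lemma hasDerivAt_tensorOp_exp (X : Matrix (Fin d) (Fin d) ℂ) (x y : Fin n → Fin d) :
    HasDerivAt (fun t : ℂ => tensorOp (fun _ : Fin n => NormedSpace.exp (t • X)) x y)
      (collective n X x y) 0 := by
  have h (i : Fin n) : HasDerivAt (fun t : ℂ => NormedSpace.exp (t • X) (x i) (y i))
      (X (x i) (y i)) 0 := by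
    have h1 := hasDerivAt_exp_smul_const (𝕂 := ℂ) X 0
    simp only [zero_smul, NormedSpace.exp_zero, one_mul] at h1
    exact (LinearMap.toContinuousLinearMap
      (Matrix.entryLinearMap ℂ ℂ (x i) (y i))).hasFDerivAt.comp_hasDerivAt 0 h1
  have h2 := HasDerivAt.fun_finsetProd (u := Finset.univ) fun i _ => h i
  simp only [zero_smul, NormedSpace.exp_zero] at h2
  refine h2.congr_deriv ?_
  simp [collective, Matrix.sum_apply, site_apply, mul_comm]

end Tensor

/-! ### The moment operators -/

section Moment

variable {d : ℕ} [NeZero d] {n : ℕ}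

/-- The average `∫ (|ψ⟩⟨ψ|)^{⊗n} dψ` of `n` copies of a random pure state. -/
noncomputable def moment (d n : ℕ) [NeZero d] : Op d n := ∫ ψ, copies n ψ ∂pureStateMeasure d

lemma integrable_copies : Integrable (copies n) (pureStateMeasure d) :=
  integrable_of_continuous continuous_copies

/-- Linear functionals commute with averaging. -/
lemma linearMap_moment (f : Op d n →ₗ[ℂ] ℂ) :
    f (moment d n) = ∫ ψ, f (copies n ψ) ∂pureStateMeasure d :=
  ((LinearMap.toContinuousLinearMap f).integral_comp_comm integrable_copies).symm

lemma moment_apply (x y : Fin n → Fin d) :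
    moment d n x y = ∫ ψ, copies n ψ x y ∂pureStateMeasure d :=
  linearMap_moment (Matrix.entryLinearMap ℂ ℂ x y)

lemma trace_mul_moment (A : Op d n) :
    (A * moment d n).trace = ∫ ψ, (A * copies n ψ).trace ∂pureStateMeasure d :=
  linearMap_moment ((Matrix.traceLinearMap _ ℂ ℂ).comp (LinearMap.mulLeft ℂ A))

lemma moment_isHermitian : (moment d n).IsHermitian := by
  ext x y
  rw [Matrix.conjTranspose_apply, moment_apply, moment_apply, ← starRingEnd_apply,
    ← integral_conj]
  simp [copies_apply, mul_comm]

lemma moment_comp_left (σ : Equiv.Perm (Fin n)) (x y : Fin n → Fin d) :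
    moment d n (x ∘ σ) y = moment d n x y := by
  simp only [moment_apply, copies_apply, Finset.prod_mul_distrib, Function.comp]
  congr 1 with ψ
  rw [Equiv.prod_comp σ fun i => ψ (x i)]

lemma moment_comp_right (σ : Equiv.Perm (Fin n)) (x y : Fin n → Fin d) :
    moment d n x (y ∘ σ) = moment d n x y := by
  rw [← moment_isHermitian.apply, moment_comp_left, moment_isHermitian.apply]

/-- Invariance of the average under `U^{⊗n}`. -/
lemma tensorOp_mul_moment {U : Matrix (Fin d) (Fin d) ℂ} (hU : U ∈ Matrix.unitaryGroup (Fin d) ℂ) :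
    tensorOp (fun _ : Fin n => U) * moment d n = moment d n * tensorOp fun _ => U := by
  have hU' : (tensorOp fun _ : Fin n => U)ᴴ * (tensorOp fun _ => U) = 1 := by
    have h : Uᴴ * U = 1 := Matrix.mem_unitaryGroup_iff'.mp hU
    rw [conjTranspose_tensorOp, tensorOp_mul, ← tensorOp_one]
    simp only [h]
  have h : tensorOp (fun _ : Fin n => U) * moment d n * (tensorOp fun _ : Fin n => U)ᴴ
      = moment d n := by
    have h1 := ((LinearMap.toContinuousLinearMap ((LinearMap.mulRight ℂ
      (tensorOp fun _ : Fin n => U)ᴴ).comp (LinearMap.mulLeft ℂ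
      (tensorOp fun _ : Fin n => U)))).integral_comp_comm (integrable_copies (d := d))).symm
    refine h1.trans (Eq.trans ?_ (integral_unitary_mulVec continuous_copies ⟨U, hU⟩))
    exact integral_congr_ae (.of_forall fun ψ => (copies_mulVec U ψ).symm)
  calc _ = tensorOp (fun _ : Fin n => U) * moment d n * ((tensorOp fun _ : Fin n => U)ᴴ
          * tensorOp (fun _ : Fin n => U)) := by rw [hU', mul_one]
    _ = _ := by rw [← mul_assoc, h]

/-- For skew-adjoint `X` the operators `exp(tX)`, `t` real, are unitary, and the derivative of the
invariance of the moment operator at `t = 0` is the claim. -/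
lemma collective_mul_moment_of_skew {X : Matrix (Fin d) (Fin d) ℂ}
    (hX : X ∈ skewAdjoint (Matrix (Fin d) (Fin d) ℂ)) :
    collective n X * moment d n = moment d n * collective n X := by
  ext x y
  have h1 : HasDerivAt (fun t : ℂ =>
      (tensorOp (fun _ : Fin n => NormedSpace.exp (t • X)) * moment d n) x y)
      ((collective n X * moment d n) x y) 0 := by
    simp only [Matrix.mul_apply]
    exact HasDerivAt.fun_sum fun u _ => (hasDerivAt_tensorOp_exp X x u).mul_const _
  have h2 : HasDerivAt (fun t : ℂ =>
      (moment d n * tensorOp (fun _ : Fin n => NormedSpace.exp (t • X))) x y)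
      ((moment d n * collective n X) x y) 0 := by
    simp only [Matrix.mul_apply]
    exact HasDerivAt.fun_sum fun u _ => (hasDerivAt_tensorOp_exp X u y).const_mul _
  have h1' := HasDerivAt.comp_ofReal (z := 0) (by simpa using h1)
  have h2' := HasDerivAt.comp_ofReal (z := 0) (by simpa using h2)
  refine h1'.unique (h2'.congr_of_eventuallyEq (.of_forall fun t => ?_))
  have hU : NormedSpace.exp ((t : ℂ) • X) ∈ Matrix.unitaryGroup (Fin d) ℂ := by
    let : NormedAlgebra ℚ (Matrix (Fin d) (Fin d) ℂ) := NormedAlgebra.restrictScalars ℚ ℂ _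
    refine NormedSpace.exp_mem_unitary_of_mem_skewAdjoint ?_
    rw [skewAdjoint.mem_iff] at hX ⊢
    simp [star_smul, hX]
  simp only [tensorOp_mul_moment hU]

/-- Collective operators commute with the moment operators. -/
theorem collective_mul_moment (X : Matrix (Fin d) (Fin d) ℂ) :
    collective n X * moment d n = moment d n * collective n X := by
  have key (Y : Matrix (Fin d) (Fin d) ℂ) :
      collective n (Y - star Y) * moment d n = moment d n * collective n (Y - star Y) := by
    refine collective_mul_moment_of_skew ?_
    rw [skewAdjoint.mem_iff]; simp
  -- every matrix is a complex combination of skew-adjoint ones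
  have hX : X = (1 / 2 : ℂ) • (X - star X)
      + (-Complex.I / 2) • ((Complex.I • X) - star (Complex.I • X)) := by
    simp only [star_smul, RCLike.star_def, Complex.conj_I, neg_smul, sub_neg_eq_add, smul_add,
      smul_smul, smul_sub, neg_div]
    rw [show -(Complex.I / 2) * Complex.I = 1 / 2 by
      linear_combination (-1 / 2 : ℂ) * Complex.I_mul_I]
    module
  rw [hX, collective_add, collective_smul, collective_smul, add_mul, mul_add, smul_mul_assoc,
    smul_mul_assoc, mul_smul_comm, mul_smul_comm, key, key]

end Moment

/-! ### The recursion for the moment operators -/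

section Recursion

variable {d n : ℕ}

/-- Exchanging the `j`-th letter of a word with an extra letter is a bijection. -/
lemma sum_sum_update {R : Type*} [AddCommMonoid R] (j : Fin n) (F : (Fin n → Fin d) → Fin d → R) :
    ∑ y, ∑ a, F (Function.update y j a) (y j) = ∑ y, ∑ a, F y a := by
  rw [← Fintype.sum_prod_type', ← Fintype.sum_prod_type']
  refine Fintype.sum_bijective
    (fun p : (Fin n → Fin d) × Fin d => (Function.update p.1 j p.2, p.1 j)) ?_ _ _ fun _ => rfl
  refine Function.Involutive.bijective fun p => ?_
  simp

lemma cons_update_eq_comp_swap (x : Fin n → Fin d) (j : Fin n) (b : Fin d) :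
    (Fin.cons (x j) (Function.update x j b) : Fin (n + 1) → Fin d)
      = (Fin.cons b x : Fin (n + 1) → Fin d) ∘ Equiv.swap 0 j.succ := by
  ext i
  refine Fin.cases ?_ (fun i => ?_) i
  · simp
  · by_cases h : i = j
    · subst h; simp
    · simp [h, Equiv.swap_apply_of_ne_of_ne (Fin.succ_ne_zero i) (Fin.succ_injective _ |>.ne h)]

lemma sum_fun_succ {R : Type*} [AddCommMonoid R] (F : (Fin (n + 1) → Fin d) → R) :
    ∑ y, F y = ∑ a, ∑ y : Fin n → Fin d, F (Fin.cons a y) := by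
  rw [← Fintype.sum_prod_type']
  exact (Fintype.sum_equiv (Fin.consEquiv fun _ => Fin d) _ _ fun _ => rfl).symm

lemma copies_cons (ψ : Fin d → ℂ) (a b : Fin d) (x y : Fin n → Fin d) :
    copies (n + 1) ψ (Fin.cons a x) (Fin.cons b y) = ψ a * conj (ψ b) * copies n ψ x y := by
  simp [copies_apply, Fin.prod_univ_succ]

lemma copies_comp_left (ψ : Fin d → ℂ) (σ : Equiv.Perm (Fin n)) (x y : Fin n → Fin d) :
    copies n ψ (x ∘ σ) y = copies n ψ x y := by
  simp only [copies_apply, Finset.prod_mul_distrib, Function.comp]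
  rw [Equiv.prod_comp σ fun i => ψ (x i)]

lemma trace_copies {ψ : Fin d → ℂ} (h : IsUnitVector ψ) : (copies n ψ).trace = 1 := by
  rw [copies_eq_tensorOp, trace_tensorOp, Finset.prod_congr rfl fun i _ => trace_proj h]
  simp

/-- The nonzero eigenvalue `∏ₖ (k+1)/(k+d)` of `∫ ψ^{⊗n} dψ`, the inverse of the dimension of the
symmetric subspace. -/
noncomputable def momentValue (d n : ℕ) : ℝ := ∏ k ∈ Finset.range n, ((k : ℝ) + 1) / (k + d)

lemma momentValue_succ : momentValue d (n + 1) = momentValue d n * (((n : ℝ) + 1) / (n + d)) :=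
  Finset.prod_range_succ _ _

variable [NeZero d]

/-- Tracing out one factor of `∫ ψ^{⊗(n+1)} dψ` gives `∫ ψ^{⊗n} dψ`. -/
lemma sum_moment_cons (x y : Fin n → Fin d) :
    ∑ c, moment d (n + 1) (Fin.cons c x) (Fin.cons c y) = moment d n x y := by
  simp only [moment_apply]
  rw [← integral_finsetSum _ fun c _ => integrable_of_continuous
    (continuous_copies.matrix_elem _ _)]
  refine integral_congr_ae (ae_isUnitVector.mono fun ψ hψ => ?_)
  have h : ∑ c, ψ c * conj (ψ c) = 1 := by
    rw [← hψ]; simp [dotProduct, mul_comm]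
  simp only [copies_cons, ← Finset.sum_mul, h, one_mul]

/-- The commutation of `∫ ψ^{⊗n} dψ` with the collective matrix units, written out. -/
lemma sum_moment_update (b c : Fin d) (x y : Fin n → Fin d) :
    ∑ i, (if x i = c then moment d n (Function.update x i b) y else 0)
      = ∑ i, if y i = b then moment d n x (Function.update y i c) else 0 := by
  have h := congrFun (congrFun (collective_mul_moment (d := d) (n := n) (Matrix.single c b 1)) x) y
  simp only [collective, Finset.sum_mul, Finset.mul_sum, Matrix.sum_apply, mul_site_apply,
    site_mul_apply, Matrix.single_apply] at h
  convert h using 2 with i _ i _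
  · by_cases hc : c = x i <;> simp [hc, eq_comm]
  · by_cases hc : b = y i <;> simp [hc, eq_comm]

/-- Integration of one more pair of coordinates `ψ_b ψ̄_a` against the uniform distribution:
`ψ̄_a` acts like a derivative. -/
theorem moment_succ (a b : Fin d) (x y : Fin n → Fin d) :
    ((n : ℂ) + d) * moment d (n + 1) (Fin.cons b x) (Fin.cons a y)
      = (if a = b then moment d n x y else 0)
        + ∑ j, if y j = b then moment d n x (Function.update y j a) else 0 := by
  -- commutation with the matrix unit `E_{cb}`, with letters moved by permutation symmetry so that
  -- the sum over `c` closes a trace on the left and traces out a factor on the right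
  have key (c : Fin d) : moment d (n + 1) (Fin.cons b x) (Fin.cons a y)
        + ∑ j, (if x j = c then moment d (n + 1) (Fin.cons b x) (Fin.cons a y) else 0)
      = (if a = b then moment d (n + 1) (Fin.cons c x) (Fin.cons c y) else 0)
        + ∑ j, if y j = b then moment d (n + 1) (Fin.cons c x)
          (Fin.cons c (Function.update y j a)) else 0 := by
    have h := sum_moment_update b c (Fin.cons c x : Fin (n + 1) → Fin d) (Fin.cons a y)
    simp only [Fin.sum_univ_succ, Fin.cons_zero, Fin.cons_succ, if_true, Fin.update_cons_zero,
      ← Fin.cons_update] at h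
    convert h using 3 with j _ j _
    · split_ifs with hc
      · rw [← hc, cons_update_eq_comp_swap, moment_comp_left]
      · rfl
    · split_ifs with hb
      · have := cons_update_eq_comp_swap (Function.update y j a) j c
        rw [Function.update_self, Function.update_idem] at this
        rw [this, moment_comp_right]
      · rfl
  have h := Finset.sum_congr (rfl : (Finset.univ : Finset (Fin d)) = _) fun c _ => key c
  simp only [Finset.sum_add_distrib] at h
  rw [Finset.sum_comm, Finset.sum_comm (f := fun c j => if y j = b then _ else _)] at h
  simp only [Finset.sum_ite_eq, Finset.mem_univ, if_true, Finset.sum_const, Finset.card_univ,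
    Fintype.card_fin, nsmul_eq_mul] at h
  rw [add_mul, add_comm ((n : ℂ) * _), h]
  congr 1
  · split_ifs
    · exact sum_moment_cons x y
    · simp
  · refine Finset.sum_congr rfl fun j _ => ?_
    split_ifs
    · exact sum_moment_cons x _
    · simp

lemma momentValue_pos (d n : ℕ) [NeZero d] : 0 < momentValue d n := by
  have : (0 : ℝ) < d := by exact_mod_cast Nat.pos_of_neZero d
  exact Finset.prod_pos fun k _ => by positivity

/-- `∫ ψ^{⊗n} dψ` is a multiple of the identity on symmetric tensors. -/
theorem moment_mulVec {v : (Fin n → Fin d) → ℂ}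
    (hv : ∀ (σ : Equiv.Perm (Fin n)) (x : Fin n → Fin d), v (x ∘ σ) = v x) :
    moment d n *ᵥ v = (momentValue d n : ℂ) • v := by
  induction n with
  | zero =>
    ext x
    simp [Matrix.mulVec, dotProduct, moment_apply, copies_apply, momentValue]
    exact congrArg v (Subsingleton.elim _ _)
  | succ n ih =>
    have hd : (n : ℂ) + d ≠ 0 := by
      exact_mod_cast (by have := Nat.pos_of_neZero d; omega : n + d ≠ 0)
    have hcons (b : Fin d) : moment d n *ᵥ (fun y => v (Fin.cons b y))
        = (momentValue d n : ℂ) • fun y => v (Fin.cons b y) := by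
      refine ih fun σ x => ?_
      rw [← hv (Equiv.Perm.decomposeFin.symm (0, σ)) (Fin.cons b x)]
      congr 1
      ext i
      refine Fin.cases ?_ (fun i => ?_) i <;> simp
    ext z
    refine Fin.consCases (fun b x => ?_) z
    have h1 := congrFun (hcons b) x
    simp only [Matrix.mulVec, dotProduct, Pi.smul_apply, smul_eq_mul] at h1 ⊢
    have h2 (j : Fin n) : ∑ a, ∑ y : Fin n → Fin d,
        (if y j = b then moment d n x (Function.update y j a) else 0) * v (Fin.cons a y)
        = (momentValue d n : ℂ) * v (Fin.cons b x) := by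
      rw [Finset.sum_comm]
      have h3 := sum_sum_update j fun (y : Fin n → Fin d) (c : Fin d) =>
        (if c = b then moment d n x y else 0) * v (Fin.cons (y j) (Function.update y j c))
      simp only [Function.update_self, Function.update_idem, Function.update_eq_self] at h3
      rw [h3, ← h1]
      refine Finset.sum_congr rfl fun y _ => ?_
      have hc : v (Fin.cons (y j) (Function.update y j b)) = v (Fin.cons b y) := by
        rw [cons_update_eq_comp_swap, hv]
      simp only [ite_mul, zero_mul, Finset.sum_ite_eq', Finset.mem_univ, if_true, hc]
    have h3 : ((n : ℂ) + d) * ∑ z, moment d (n + 1) (Fin.cons b x) z * v z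
        = ((n : ℂ) + 1) * (momentValue d n * v (Fin.cons b x)) := by
      rw [sum_fun_succ, Finset.mul_sum]
      simp only [Finset.mul_sum]
      simp only [← mul_assoc ((n : ℂ) + d), moment_succ]
      simp only [add_mul, Finset.sum_add_distrib]
      rw [show ∀ p q r : ℂ, p + q = r ↔ q + p = r from fun p q r => by rw [add_comm]]
      congr 1
      · simp only [Finset.sum_mul]
        rw [Finset.sum_congr rfl fun a _ => Finset.sum_comm, Finset.sum_comm]
        simp only [h2]
        simp
      · rw [Finset.sum_comm]
        simp [ite_mul, h1]
    refine mul_left_cancel₀ hd (h3.trans ?_)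
    rw [momentValue_succ]
    push_cast
    field_simp

lemma moment_mul {ι : Type*} {A : Matrix (Fin n → Fin d) ι ℂ}
    (hA : ∀ (σ : Equiv.Perm (Fin n)) (x : Fin n → Fin d) (y : ι), A (x ∘ σ) y = A x y) :
    moment d n * A = (momentValue d n : ℂ) • A := by
  ext x y
  exact congrFun (moment_mulVec (v := fun x => A x y) fun σ x => hA σ x y) x

lemma moment_mul_moment : moment d n * moment d n = (momentValue d n : ℂ) • moment d n :=
  moment_mul moment_comp_left

lemma trace_moment_mul_copies {ψ : Fin d → ℂ} (h : IsUnitVector ψ) :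
    (moment d n * copies n ψ).trace = momentValue d n := by
  rw [moment_mul (copies_comp_left ψ), Matrix.trace_smul, trace_copies h, smul_eq_mul, mul_one]

/-- The moments of the overlap with a fixed state. -/
lemma integral_overlap_pow {φ : Fin d → ℂ} (h : IsUnitVector φ) :
    ∫ ψ, (‖star φ ⬝ᵥ ψ‖ ^ 2) ^ n ∂pureStateMeasure d = momentValue d n := by
  have h1 : (moment d n * copies n φ).trace
      = ((∫ ψ, (‖star φ ⬝ᵥ ψ‖ ^ 2) ^ n ∂pureStateMeasure d : ℝ) : ℂ) := by
    rw [Matrix.trace_mul_comm, trace_mul_moment, ← integral_complex_ofReal]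
    congr 1 with ψ
    rw [copies_eq_tensorOp, copies_eq_tensorOp, tensorOp_mul, trace_tensorOp]
    simp [trace_proj_mul_proj]
  rw [trace_moment_mul_copies h] at h1
  exact_mod_cast h1.symm

end Recursion

/-! ### Operator inequalities -/

section Order

variable {ι : Type*}

lemma ofReal_smul_nonneg {P : Matrix ι ι ℂ} (hP : 0 ≤ P) {c : ℝ} (hc : 0 ≤ c) :
    0 ≤ (c : ℂ) • P :=
  Matrix.nonneg_iff_posSemidef.mpr
    ((Matrix.nonneg_iff_posSemidef.mp hP).smul (Complex.zero_le_real.mpr hc))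

variable [Fintype ι]

lemma trace_mul_re_nonneg {P Q : Matrix ι ι ℂ} (hP : 0 ≤ P) (hQ : 0 ≤ Q) :
    0 ≤ (P * Q).trace.re := by
  classical
  obtain ⟨B, rfl⟩ := CStarAlgebra.nonneg_iff_eq_star_mul_self.mp hP
  rw [mul_assoc, Matrix.trace_mul_comm, mul_assoc, ← mul_assoc]
  exact (Complex.nonneg_iff.mp
    ((Matrix.nonneg_iff_posSemidef.mp hQ).mul_mul_conjTranspose_same B).trace_nonneg).1

lemma trace_mul_re_le {P Q R : Matrix ι ι ℂ} (hP : 0 ≤ P) (h : Q ≤ R) :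
    (P * Q).trace.re ≤ (P * R).trace.re := by
  have := trace_mul_re_nonneg hP (sub_nonneg.mpr h)
  rw [mul_sub, Matrix.trace_sub, Complex.sub_re] at this
  linarith

variable [DecidableEq ι]

/-- A Hermitian operator with `S² ≤ c S` has no eigenvalue above `c`. -/
lemma le_smul_one_of_mul_self_le {S : Matrix ι ι ℂ} (hS : S.IsHermitian) {c : ℝ} (hc : 0 < c)
    (h : S * S ≤ (c : ℂ) • S) : S ≤ (c : ℂ) • (1 : Matrix ι ι ℂ) := by
  have hc' : (c : ℂ) ≠ 0 := by exact_mod_cast hc.ne'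
  set D : Matrix ι ι ℂ := (c : ℂ) • 1 - S with hD
  have hDstar : star D = D := by
    have h1 : star S = S := hS
    simp [hD, star_sub, h1]
  have h1 : D = (((c⁻¹ : ℝ)) : ℂ) • (star D * D + ((c : ℂ) • S - S * S)) := by
    rw [hDstar, hD]
    simp only [mul_sub, sub_mul, smul_mul_assoc, mul_smul_comm, one_mul, mul_one, smul_sub,
      smul_add, smul_smul, Complex.ofReal_inv, inv_mul_cancel₀ hc', inv_mul_cancel_left₀ hc',
      one_smul]
    abel
  rw [← sub_nonneg, ← hD, h1]
  exact ofReal_smul_nonneg (add_nonneg (star_mul_self_nonneg D) (sub_nonneg.mpr h))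
    (inv_nonneg.mpr hc.le)

lemma mul_le_smul_of_commute {A C : Matrix ι ι ℂ} (hA : 0 ≤ A) (hAC : Commute A C) {c : ℂ}
    (hC : C ≤ c • (1 : Matrix ι ι ℂ)) : A * C ≤ c • A := by
  have h := Commute.mul_nonneg hA (sub_nonneg.mpr hC)
    (((Commute.one_right A).smul_right c).sub_right hAC)
  rw [← sub_nonneg]
  convert h using 1
  simp [mul_sub]

end Order

section Positivity

variable {d n : ℕ}

lemma copies_nonneg (ψ : Fin d → ℂ) : 0 ≤ copies n ψ := by
  have h : copies n ψ = Matrix.vecMulVec (fun x => ∏ i, ψ (x i)) (star fun x => ∏ i, ψ (x i)) := by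
    ext x y
    simp [copies_apply, Matrix.vecMulVec_apply, Finset.prod_mul_distrib]
  rw [h, Matrix.nonneg_iff_posSemidef]
  exact Matrix.posSemidef_vecMulVec_self_star _

lemma site_proj_le_one (i : Fin n) {φ : Fin d → ℂ} (h : IsUnitVector φ) :
    site i (proj φ) ≤ 1 := by
  have h1 : (site i (proj φ)).IsHermitian := by
    rw [Matrix.IsHermitian, conjTranspose_site, conjTranspose_proj]
  simpa using le_smul_one_of_mul_self_le h1 one_pos
    (by rw [site_mul_site, proj_mul_proj h]; simp)

lemma collective_proj_le {φ : Fin d → ℂ} (h : IsUnitVector φ) :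
    collective n (proj φ) ≤ (n : ℂ) • (1 : Op d n) := by
  refine (Finset.sum_le_sum fun i _ => site_proj_le_one i h).trans_eq ?_
  simp [Nat.cast_smul_eq_nsmul]

variable [NeZero d]

lemma moment_nonneg : 0 ≤ moment d n := by
  have h : moment d n = ((((momentValue d n)⁻¹ : ℝ)) : ℂ) • (star (moment d n) * moment d n) := by
    have h1 : star (moment d n) = moment d n := moment_isHermitian
    have h2 : (momentValue d n : ℂ) ≠ 0 := by exact_mod_cast (momentValue_pos d n).ne'
    rw [h1, moment_mul_moment, smul_smul, Complex.ofReal_inv, inv_mul_cancel₀ h2, one_smul]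
  rw [h]
  exact ofReal_smul_nonneg (star_mul_self_nonneg (moment d n))
    (inv_nonneg.mpr (momentValue_pos d n).le)

lemma moment_le : moment d n ≤ (momentValue d n : ℂ) • (1 : Op d n) := by
  refine le_smul_one_of_mul_self_le moment_isHermitian (momentValue_pos d n) ?_
  rw [moment_mul_moment]

lemma trace_moment : (moment d n).trace = 1 := by
  have h := trace_mul_moment (d := d) (1 : Op d n)
  rw [one_mul] at h
  rw [h, integral_congr_ae (g := fun _ => (1 : ℂ))
    (ae_isUnitVector.mono fun ψ hψ => by simp [trace_copies hψ])]
  simp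

end Positivity

/-! ### Challenge estimation -/

section Estimation

variable {d n : ℕ}

lemma continuous_overlap (φ : Fin d → ℂ) :
    Continuous fun ψ : Fin d → ℂ => ((‖star φ ⬝ᵥ ψ‖ ^ 2 : ℝ) : ℂ) := by
  fun_prop

variable [NeZero d]

/-- The average of `ψ^{⊗n}` weighted with the overlap `|⟨φ|ψ⟩|²`. -/
noncomputable def weightedMoment (n : ℕ) (φ : Fin d → ℂ) : Op d n :=
  ∫ ψ, ((‖star φ ⬝ᵥ ψ‖ ^ 2 : ℝ) : ℂ) • copies n ψ ∂pureStateMeasure d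

lemma linearMap_weightedMoment (φ : Fin d → ℂ) (f : Op d n →ₗ[ℂ] ℂ) :
    f (weightedMoment n φ)
      = ∫ ψ, ((‖star φ ⬝ᵥ ψ‖ ^ 2 : ℝ) : ℂ) * f (copies n ψ) ∂pureStateMeasure d := by
  have hint : Integrable (fun ψ : Fin d → ℂ => ((‖star φ ⬝ᵥ ψ‖ ^ 2 : ℝ) : ℂ) • copies n ψ)
      (pureStateMeasure d) :=
    integrable_of_continuous ((continuous_overlap φ).smul continuous_copies)
  refine ((LinearMap.toContinuousLinearMap f).integral_comp_comm hint).symm.trans ?_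
  simp

lemma weightedMoment_eq {φ : Fin d → ℂ} (hφ : IsUnitVector φ) :
    ((n : ℂ) + d) • weightedMoment n φ
      = moment d n + moment d n * collective n (proj φ) := by
  have hφ' : ∑ a, φ a * conj (φ a) = 1 := by
    rw [← hφ]; simp [dotProduct, mul_comm]
  have h1 (x y : Fin n → Fin d) : weightedMoment n φ x y = ∑ a, ∑ b, φ a * conj (φ b)
      * moment d (n + 1) (Fin.cons b x) (Fin.cons a y) := by
    refine (linearMap_weightedMoment φ (Matrix.entryLinearMap ℂ ℂ x y)).trans ?_
    simp only [moment_apply, ← integral_const_mul]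
    have hint (a b : Fin d) : Integrable (fun ψ : Fin d → ℂ => φ a * conj (φ b)
        * copies (n + 1) ψ (Fin.cons b x) (Fin.cons a y)) (pureStateMeasure d) :=
      integrable_of_continuous (continuous_const.mul (continuous_copies.matrix_elem _ _))
    simp_rw [← integral_finsetSum _ fun b _ => hint _ b]
    rw [← integral_finsetSum _ fun a _ => integrable_finsetSum _ fun b _ => hint a b]
    congr 1 with ψ
    rw [← Complex.normSq_eq_norm_sq, ← Complex.mul_conj]
    simp only [dotProduct, map_sum, Finset.sum_mul, Finset.mul_sum, copies_cons]
    refine Finset.sum_congr rfl fun a _ => Finset.sum_congr rfl fun b _ => ?_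
    simp
    ring
  ext x y
  have h2 (a b : Fin d) : ((n : ℂ) + d) * (φ a * conj (φ b)
      * moment d (n + 1) (Fin.cons b x) (Fin.cons a y)) = φ a * conj (φ b) *
      ((if a = b then moment d n x y else 0)
        + ∑ j, if y j = b then moment d n x (Function.update y j a) else 0) := by
    rw [← moment_succ]; ring
  simp only [Matrix.smul_apply, h1, smul_eq_mul, Finset.mul_sum, h2]
  simp only [mul_add, Finset.sum_add_distrib, collective, Finset.mul_sum, Matrix.add_apply,
    Matrix.sum_apply, mul_site_apply]
  congr 1
  · simp [← Finset.sum_mul, hφ']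
  · rw [Finset.sum_congr rfl fun a _ => Finset.sum_comm, Finset.sum_comm]
    refine Finset.sum_congr rfl fun j _ => Finset.sum_congr rfl fun a _ => ?_
    simp [proj, Matrix.vecMulVec_apply]
    ring

lemma natCast_add_pos (d n : ℕ) [NeZero d] : (0 : ℝ) < n + d := by
  exact_mod_cast (by have := Nat.pos_of_neZero d; omega : 0 < n + d)

/-- Guessing a state costs a factor `(n+1)/(n+d)`. -/
lemma weightedMoment_le {φ : Fin d → ℂ} (hφ : IsUnitVector φ) :
    weightedMoment n φ ≤ ((((n : ℝ) + 1) / (n + d) : ℝ) : ℂ) • moment d n := by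
  have hpos := natCast_add_pos d n
  have hne : (n : ℂ) + d ≠ 0 := by exact_mod_cast hpos.ne'
  have h1 : moment d n * collective n (proj φ) ≤ (n : ℂ) • moment d n :=
    mul_le_smul_of_commute moment_nonneg (collective_mul_moment (proj φ)).symm
      (collective_proj_le hφ)
  have h2 := ofReal_smul_nonneg (sub_nonneg.mpr h1) (inv_nonneg.mpr hpos.le)
  rw [← sub_nonneg]
  convert h2 using 1
  have h3 : weightedMoment n φ = (((n : ℂ) + d)⁻¹) •
      (moment d n + moment d n * collective n (proj φ)) := by
    rw [← weightedMoment_eq hφ, smul_smul, inv_mul_cancel₀ hne, one_smul]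
  rw [h3]
  push_cast
  rw [div_eq_inv_mul, mul_smul, ← smul_sub, add_smul, one_smul]
  congr 1
  abel

/-- The contribution of an effect `A` with guess `φ` to the fidelity. -/
lemma integral_effect (A : Op d n) (φ : Fin d → ℂ) :
    ∫ ψ, (A * copies n ψ).trace.re * ‖star φ ⬝ᵥ ψ‖ ^ 2 ∂pureStateMeasure d
      = (A * weightedMoment n φ).trace.re := by
  have h := linearMap_weightedMoment φ ((Matrix.traceLinearMap _ ℂ ℂ).comp (LinearMap.mulLeft ℂ A))
  simp only [LinearMap.comp_apply, LinearMap.mulLeft_apply, Matrix.traceLinearMap_apply] at h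
  have hint : Integrable (fun ψ : Fin d → ℂ => ((‖star φ ⬝ᵥ ψ‖ ^ 2 : ℝ) : ℂ)
      * (A * copies n ψ).trace) (pureStateMeasure d) :=
    integrable_of_continuous ((continuous_overlap φ).mul
      (continuous_const.matrix_mul continuous_copies).matrix_trace)
  rw [h]
  refine Eq.trans ?_ (integral_re hint)
  congr 1 with ψ
  rw [mul_comm]
  exact (Complex.re_ofReal_mul _ _).symm

lemma weightedMoment_effect_nonneg {A : Op d n} (hA : 0 ≤ A) (φ : Fin d → ℂ) :
    0 ≤ (A * weightedMoment n φ).trace.re := by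
  rw [← integral_effect]
  exact integral_nonneg fun ψ => mul_nonneg
    (trace_mul_re_nonneg hA (copies_nonneg ψ)) (by positivity)

/-- No estimation strategy has a fidelity above `(N+1)/(N+d)`. -/
theorem Estimation.fidelity_le (E : Estimation d n) :
    E.fidelity ≤ ((n : ℝ) + 1) / (n + d) := by
  set c : ℝ := ((n : ℝ) + 1) / (n + d)
  have hE (j : ℕ) : 0 ≤ E.effect j := Matrix.nonneg_iff_posSemidef.mpr (E.effect_posSemidef j)
  have hsum : HasSum (fun j => c * (E.effect j * moment d n).trace.re) c := by
    let f : Op d n →ₗ[ℂ] ℂ :=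
      (Matrix.traceLinearMap _ ℂ ℂ).comp (LinearMap.mulRight ℂ (moment d n))
    have h1 := E.effect_sum.mapL (LinearMap.toContinuousLinearMap f)
    have h2 := (Complex.hasSum_re h1).mul_left c
    simpa [f, trace_moment] using h2
  have hle (j : ℕ) : (E.effect j * weightedMoment n (E.guess j)).trace.re
      ≤ c * (E.effect j * moment d n).trace.re := by
    have := trace_mul_re_le (hE j) (weightedMoment_le (n := n) (E.guess_unit j))
    rwa [mul_smul_comm, Matrix.trace_smul, smul_eq_mul, Complex.re_ofReal_mul] at this
  rw [Estimation.fidelity, ← hsum.tsum_eq]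
  simp only [integral_effect]
  exact (Summable.of_nonneg_of_le (fun j => weightedMoment_effect_nonneg (hE j) _) hle
    hsum.summable).tsum_le_tsum hle hsum.summable

/-- A measurement with finitely many outcomes, indexed by any finite type, becomes an `Estimation`
after padding with zero effects. -/
lemma exists_estimation {ι : Type*} [Fintype ι] (F : ι → Op d n) (hF : ∀ i, 0 ≤ F i)
    (hsum : ∑ i, F i = 1) (g : ι → Fin d → ℂ) (hg : ∀ i, IsUnitVector (g i)) :
    ∃ E : Estimation d n, E.fidelity = ∑ i, (F i * weightedMoment n (g i)).trace.re := by
  let f : ι → ℕ := fun i => (Fintype.equivFin ι i : ℕ)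
  have hf : Function.Injective f := Fin.val_injective.comp (Fintype.equivFin ι).injective
  have hcases (j : ℕ) : (∃ i, f i = j) ∨ (¬ ∃ i, f i = j) := em _
  refine ⟨⟨Function.extend f F 0, fun j => ?_, ?_, Function.extend f g fun _ => Pi.single 0 1,
    fun j => ?_⟩, ?_⟩
  · rcases hcases j with ⟨i, rfl⟩ | hj
    · rw [hf.extend_apply]; exact Matrix.nonneg_iff_posSemidef.mp (hF i)
    · rw [Function.extend_apply' _ _ _ hj]; exact Matrix.PosSemidef.zero
  · rw [hasSum_extend_zero hf, ← hsum]
    exact hasSum_fintype F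
  · rcases hcases j with ⟨i, rfl⟩ | hj
    · rw [hf.extend_apply]; exact hg i
    · rw [Function.extend_apply' _ _ _ hj]; exact isUnitVector_single 0
  · simp only [Estimation.fidelity, integral_effect]
    refine HasSum.tsum_eq ?_
    rw [← hf.hasSum_iff]
    · convert hasSum_fintype fun i => (F i * weightedMoment n (g i)).trace.re using 2 with i
      simp [hf.extend_apply]
    · intro j hj
      rw [Function.extend_apply' _ _ _ hj]
      simp

lemma trace_copies_mul_weightedMoment {φ : Fin d → ℂ} (hφ : IsUnitVector φ) :
    (copies n φ * weightedMoment n φ).trace.re = momentValue d (n + 1) := by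
  rw [← integral_effect, ← integral_overlap_pow hφ]
  congr 1 with ψ
  rw [copies_eq_tensorOp, copies_eq_tensorOp, tensorOp_mul, trace_tensorOp]
  simp only [trace_proj_mul_proj, Finset.prod_const, Finset.card_univ, Fintype.card_fin]
  rw [← Complex.ofReal_pow, Complex.ofReal_re]
  exact (pow_succ _ _).symm

/-- Finitely many product states that average to `∫ ψ^{⊗n} dψ` up to `ε` give a measurement
with almost optimal fidelity. -/
lemma exists_estimation_fidelity_ge {ε : ℝ} (hε : 0 < ε) :
    ∃ E : Estimation d n, momentValue d (n + 1) / (momentValue d n + ε) ≤ E.fidelity := by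
  have hm := momentValue_pos d n
  set S : Set (Op d n) := copies n '' {ψ | IsUnitVector ψ}
  have hmem : moment d n ∈ closure (convexHull ℝ S) := by
    refine (convex_convexHull ℝ S).closure.integral_mem isClosed_closure ?_ integrable_copies
    exact ae_isUnitVector.mono fun ψ hψ =>
      subset_closure (subset_convexHull ℝ S ⟨ψ, hψ, rfl⟩)
  obtain ⟨ν, hν, hdist⟩ := Metric.mem_closure_iff.mp hmem ε hε
  obtain ⟨ι, _, w, z, hw, hw1, hz, hzν⟩ := mem_convexHull_iff_exists_fintype.mp hν
  choose φ hφ hφz using hz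
  have hzν' : ∑ i, (w i : ℂ) • copies n (φ i) = ν := by
    rw [← hzν]
    exact Finset.sum_congr rfl fun i _ => by rw [hφz, Complex.coe_smul]
  have hνle : ν ≤ ((momentValue d n + ε : ℝ) : ℂ) • (1 : Op d n) := by
    have hνh : IsSelfAdjoint (ν - moment d n) := by
      refine IsSelfAdjoint.sub ?_ moment_isHermitian
      rw [← hzν']
      exact IsSelfAdjoint.of_nonneg
        (Finset.sum_nonneg fun i _ => ofReal_smul_nonneg (copies_nonneg _) (hw i))
    have h1 := hνh.le_algebraMap_norm_self
    have h2 : algebraMap ℝ (Op d n) ‖ν - moment d n‖ ≤ (ε : ℂ) • (1 : Op d n) := by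
      have h3 : ‖ν - moment d n‖ ≤ ε := by rw [← dist_eq_norm, dist_comm]; exact hdist.le
      have h4 := ofReal_smul_nonneg (ι := Fin n → Fin d) (P := 1) (by
        rw [Matrix.nonneg_iff_posSemidef]; exact Matrix.PosSemidef.one) (sub_nonneg.mpr h3)
      rw [← sub_nonneg]
      convert h4 using 1
      rw [Algebra.algebraMap_eq_smul_one, Complex.ofReal_sub, sub_smul, Complex.coe_smul ‖_‖]
    have h5 := add_le_add (h1.trans h2) (moment_le (d := d) (n := n))
    rw [sub_add_cancel, ← add_smul] at h5
    rwa [add_comm (momentValue d n), Complex.ofReal_add]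
  -- the effects are `c wᵢ φᵢ^{⊗n}`, completed to a measurement by `1 - c ν`
  set c : ℝ := (momentValue d n + ε)⁻¹
  have hc : 0 < c := by positivity
  have hcν : (c : ℂ) • ν ≤ 1 := by
    have h := ofReal_smul_nonneg (sub_nonneg.mpr hνle) hc.le
    rw [smul_sub, smul_smul, ← Complex.ofReal_mul, inv_mul_cancel₀ (by positivity),
      Complex.ofReal_one, one_smul] at h
    exact sub_nonneg.mp h
  obtain ⟨E, hE⟩ := exists_estimation (ι := Option ι)
    (fun i => i.elim (1 - (c : ℂ) • ν) fun i => ((c * w i : ℝ) : ℂ) • copies n (φ i))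
    (by
      rintro (_ | i)
      · exact sub_nonneg.mpr hcν
      · exact ofReal_smul_nonneg (copies_nonneg _) (mul_nonneg hc.le (hw i)))
    (by simp only [Fintype.sum_option, Option.elim, Complex.ofReal_mul, mul_smul,
      ← Finset.smul_sum, hzν', sub_add_cancel])
    (fun i => i.elim (Pi.single 0 1) φ)
    (by
      rintro (_ | i)
      · exact isUnitVector_single 0
      · exact hφ i)
  refine ⟨E, ?_⟩
  rw [hE, Fintype.sum_option]
  have h1 : ∑ i, (((c * w i : ℝ) : ℂ) • copies n (φ i) * weightedMoment n (φ i)).trace.re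
      = momentValue d (n + 1) / (momentValue d n + ε) := by
    simp only [smul_mul_assoc, Matrix.trace_smul, smul_eq_mul, Complex.re_ofReal_mul,
      trace_copies_mul_weightedMoment (hφ _)]
    rw [← Finset.sum_mul, ← Finset.mul_sum, hw1, mul_one, div_eq_inv_mul]
  rw [← h1]
  exact le_add_of_nonneg_left (weightedMoment_effect_nonneg (sub_nonneg.mpr hcν) _)

/-- The optimal fidelity of challenge estimation. -/
theorem optEst_eq : optEst d n = ((n : ℝ) + 1) / (n + d) := by
  have hub : ∀ f ∈ Set.range fun E : Estimation d n => E.fidelity, f ≤ ((n : ℝ) + 1) / (n + d) := by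
    rintro _ ⟨E, rfl⟩
    exact E.fidelity_le
  have hm := momentValue_pos d n
  refine le_antisymm (csSup_le ?_ hub) ?_
  · obtain ⟨E, -⟩ := exists_estimation_fidelity_ge (d := d) (n := n) one_pos
    exact ⟨_, E, rfl⟩
  · have hlim : Filter.Tendsto (fun ε : ℝ => momentValue d (n + 1) / (momentValue d n + ε))
        (nhdsWithin 0 (Set.Ioi 0)) (nhds (momentValue d (n + 1) / (momentValue d n + 0))) := by
      refine Filter.Tendsto.mono_left ?_ nhdsWithin_le_nhds
      refine ContinuousAt.tendsto (x := (0 : ℝ)) (f := fun ε : ℝ =>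
        momentValue d (n + 1) / (momentValue d n + ε)) ?_
      exact ContinuousAt.div (by fun_prop) (by fun_prop) (by simpa using hm.ne')
    rw [add_zero, momentValue_succ, mul_div_cancel_left₀ _ hm.ne'] at hlim
    refine le_of_tendsto hlim (eventually_nhdsWithin_of_forall fun ε hε => ?_)
    obtain ⟨E, hE⟩ := exists_estimation_fidelity_ge (d := d) (n := n) (Set.mem_Ioi.mp hε)
    rw [momentValue_succ] at hE
    exact hE.trans (le_csSup ⟨_, hub⟩ ⟨E, rfl⟩)

end Estimation

/-! ### Choi and Kraus representations -/

section Kraus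

lemma exists_eq_star_mul_self {A : Type*} [NonUnitalCStarAlgebra A] [PartialOrder A]
    [StarOrderedRing A] {a : A} (ha : 0 ≤ a) : ∃ b, a = star b * b :=
  CStarAlgebra.nonneg_iff_eq_star_mul_self.mp ha

variable {d N M : ℕ}

/-- The Choi matrix of a completely positive map is positive semidefinite, hence a sum of
rank-one operators `∑ₛ w̄ₛ wₛᵀ`. -/
lemma exists_choi (L : CompletelyPositiveMap (Op d N) (Op d M)) :
    ∃ w : (Fin N → Fin d) × (Fin M → Fin d) → (Fin N → Fin d) × (Fin M → Fin d) → ℂ,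
      ∀ x x' y y', L (Matrix.single x x' 1) y y' = ∑ s, conj (w s (x, y)) * w s (x', y') := by
  let E : CStarMatrix (Fin N → Fin d) (Fin N → Fin d) (Op d N) :=
    CStarMatrix.ofMatrix fun x x' => Matrix.single x x' 1
  have hE : 0 ≤ E := by
    rcases isEmpty_or_nonempty (Fin N → Fin d) with h | ⟨⟨k⟩⟩
    · exact le_of_eq (CStarMatrix.ext fun i => h.elim i)
    · -- `E` is the square of the operator with the row `(E_{k x})ₓ` as its only nonzero row
      let X : CStarMatrix (Fin N → Fin d) (Fin N → Fin d) (Op d N) :=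
        CStarMatrix.ofMatrix fun l x => if l = k then Matrix.single k x 1 else 0
      have h : E = star X * X := by
        have hX (l x) : X l x = if l = k then Matrix.single k x 1 else 0 := rfl
        refine CStarMatrix.ext fun x x' => ?_
        rw [CStarMatrix.mul_apply, Finset.sum_eq_single k]
        · rw [CStarMatrix.star_apply, hX, hX, if_pos rfl, if_pos rfl, Matrix.star_eq_conjTranspose,
            Matrix.conjTranspose_single, Matrix.single_mul_single_same,
            star_one, one_mul]
          rfl
        · intro l _ hl
          rw [hX, if_neg hl, mul_zero]
        · simp
      rw [h]
      exact star_mul_self_nonneg X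
  obtain ⟨B, hB⟩ := exists_eq_star_mul_self (L.map_cstarMatrix_nonneg E hE)
  refine ⟨fun s p => B s.1 p.1 s.2 p.2, fun x x' y y' => ?_⟩
  have h : L (Matrix.single x x' 1) = (E.map L) x x' := rfl
  rw [h, hB, CStarMatrix.mul_apply, Fintype.sum_prod_type]
  simp [Matrix.sum_apply, Matrix.mul_apply, CStarMatrix.star_apply]

variable [NeZero d]

/-- The completely positive map `ρ ↦ ∑ₖ Kₖ ρ Kₖᴴ`. -/
noncomputable def krausMap {κ : Type*} [Fintype κ]
    (K : κ → Matrix (Fin M → Fin d) (Fin N → Fin d) ℂ) :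
    CompletelyPositiveMap (Op d N) (Op d M) where
  toFun ρ := ∑ k, K k * ρ * (K k)ᴴ
  map_add' ρ σ := by simp [Matrix.mul_add, Matrix.add_mul, Finset.sum_add_distrib]
  map_smul' c ρ := by simp [Finset.smul_sum]
  map_cstarMatrix_nonneg' m A hA := by
    obtain ⟨B, rfl⟩ := exists_eq_star_mul_self hA
    -- the rows of the rectangular matrices `B l i * (K k)ᴴ`, as square matrices
    let D (k : κ) (r : Fin N → Fin d) : CStarMatrix (Fin m) (Fin m) (Op d M) :=
      CStarMatrix.ofMatrix fun l i => Matrix.of fun y y' =>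
        if y = 0 then (B l i * (K k)ᴴ) r y' else 0
    have hD (k r l i y y') : D k r l i y y' = if y = 0 then (B l i * (K k)ᴴ) r y' else 0 := rfl
    have h : (star B * B).map (fun ρ => ∑ k, K k * ρ * (K k)ᴴ)
        = ∑ k, ∑ r, star (D k r) * D k r := by
      refine CStarMatrix.ext fun i j => ?_
      have hsum (F : κ → (Fin N → Fin d) → CStarMatrix (Fin m) (Fin m) (Op d M)) :
          (∑ k, ∑ r, F k r) i j = ∑ k, ∑ r, F k r i j := by
        rw [show (∑ k, ∑ r, F k r) i j = ((∑ k, ∑ r, CStarMatrix.ofMatrix.symm (F k r) :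
          Matrix (Fin m) (Fin m) (Op d M))) i j from rfl]
        simp [Matrix.sum_apply]
      rw [hsum, CStarMatrix.map_apply]
      refine Finset.sum_congr rfl fun k _ => ?_
      simp only [CStarMatrix.mul_apply, CStarMatrix.star_apply]
      rw [Finset.sum_comm, Matrix.mul_sum, Matrix.sum_mul]
      refine Finset.sum_congr rfl fun l _ => ?_
      have h1 : K k * (star (B l i) * B l j) * (K k)ᴴ = (B l i * (K k)ᴴ)ᴴ * (B l j * (K k)ᴴ) := by
        simp only [Matrix.conjTranspose_mul, Matrix.conjTranspose_conjTranspose, Matrix.mul_assoc,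
          Matrix.star_eq_conjTranspose]
      rw [h1]
      ext y y'
      rw [Matrix.mul_apply, Matrix.sum_apply]
      refine Finset.sum_congr rfl fun r _ => ?_
      have h2 : (star (D k r l i) * D k r l j) y y'
          = conj ((B l i * (K k)ᴴ) r y) * (B l j * (K k)ᴴ) r y' := by
        rw [Matrix.mul_apply, Finset.sum_eq_single 0]
        · rw [Matrix.star_apply, hD, hD, if_pos rfl, if_pos rfl]; rfl
        · intro u _ hu
          rw [Matrix.star_apply, hD, if_neg hu, star_zero, zero_mul]
        · simp
      rw [h2, Matrix.conjTranspose_apply]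
      rfl
    refine le_of_le_of_eq ?_ h.symm
    exact Finset.sum_nonneg fun k _ => Finset.sum_nonneg fun r _ => star_mul_self_nonneg _

/-- The quantum channel with Kraus operators `Kₖ`. -/
noncomputable def krausQCM {κ : Type*} [Fintype κ]
    (K : κ → Matrix (Fin M → Fin d) (Fin N → Fin d) ℂ) (hK : ∑ k, (K k)ᴴ * K k = 1) :
    QCM d N M where
  toMap := krausMap K
  trace_map ρ := by
    change (∑ k, K k * ρ * (K k)ᴴ).trace = _
    have h : (∑ k, K k * ρ * (K k)ᴴ).trace = ((∑ k, (K k)ᴴ * K k) * ρ).trace := by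
      rw [Matrix.trace_sum, Finset.sum_mul, Matrix.trace_sum]
      exact Finset.sum_congr rfl fun k _ => by rw [Matrix.trace_mul_comm, Matrix.mul_assoc]
    rw [h, hK, one_mul]

lemma krausQCM_apply {κ : Type*} [Fintype κ]
    (K : κ → Matrix (Fin M → Fin d) (Fin N → Fin d) ℂ) (hK : ∑ k, (K k)ᴴ * K k = 1) (ρ : Op d N) :
    (krausQCM K hK).toMap ρ = ∑ k, K k * ρ * (K k)ᴴ := rfl

end Kraus

/-! ### Contractions between input and output factors -/

section Contraction

variable {d N M : ℕ}

lemma sum_site_mul (i : Fin N) (X : Matrix (Fin d) (Fin d) ℂ) (x : Fin N → Fin d)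
    (f : (Fin N → Fin d) → ℂ) :
    ∑ u, site i X x u * f u = ∑ a, X (x i) a * f (Function.update x i a) :=
  site_mul_apply (Matrix.of fun u (_ : Unit) => f u) i X x ()

/-- Pairs of words index the product basis of `(ℂ^d)^{⊗N} ⊗ (ℂ^d)^{⊗M}`. -/
abbrev BiWord (d N M : ℕ) : Type := (Fin N → Fin d) × (Fin M → Fin d)

open scoped Kronecker in
/-- The operator `|Ω⟩⟨Ω|` on `(ℂ^d)^{⊗N} ⊗ (ℂ^d)^{⊗M}`, where `|Ω⟩ = ∑ₐ |a⟩|a⟩` lives on the `j`-th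
factor on the left and the `k`-th factor on the right. -/
def contraction (d : ℕ) (j : Fin N) (k : Fin M) :
    Matrix (BiWord d N M) (BiWord d N M) ℂ :=
  ∑ a, ∑ b, site j (Matrix.single a b 1) ⊗ₖ site k (Matrix.single a b 1)

lemma sum_contraction_mul (j : Fin N) (k : Fin M) (p : BiWord d N M) (f : BiWord d N M → ℂ) :
    ∑ u, contraction d j k p u * f u = if p.1 j = p.2 k then
      ∑ a, f (Function.update p.1 j a, Function.update p.2 k a) else 0 := by
  simp only [contraction, Matrix.sum_apply, Finset.sum_mul, Matrix.kroneckerMap_apply]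
  rw [Finset.sum_comm]
  simp_rw [Finset.sum_comm (s := (Finset.univ : Finset (BiWord d N M))), Fintype.sum_prod_type,
    mul_assoc, ← Finset.mul_sum, sum_site_mul, Matrix.single_apply]
  rw [Finset.sum_eq_single (p.1 j)]
  · split_ifs with h
    · refine Finset.sum_congr rfl fun b _ => ?_
      simp [h]
    · refine Finset.sum_eq_zero fun b _ => ?_
      simp [h]
  · intro a _ ha
    simp [ha]
  · simp

lemma contraction_mul_apply {ι : Type*} (j : Fin N) (k : Fin M)
    (X : Matrix (BiWord d N M) ι ℂ) (p : BiWord d N M)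
    (q : ι) :
    (contraction d j k * X) p q = if p.1 j = p.2 k then
      ∑ a, X (Function.update p.1 j a, Function.update p.2 k a) q else 0 :=
  sum_contraction_mul j k p fun u => X u q

lemma conjTranspose_contraction (j : Fin N) (k : Fin M) :
    (contraction d j k : Matrix (BiWord d N M) _ ℂ)ᴴ = contraction d j k := by
  simp only [contraction, Matrix.conjTranspose_sum, Matrix.conjTranspose_kronecker,
    conjTranspose_site, Matrix.conjTranspose_single, star_one]
  exact Finset.sum_comm

lemma mul_contraction_apply {ι : Type*} (j : Fin N) (k : Fin M)
    (X : Matrix ι (BiWord d N M) ℂ) (p : ι) (q : BiWord d N M) :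
    (X * contraction d j k) p q = if q.1 j = q.2 k then
      ∑ a, X p (Function.update q.1 j a, Function.update q.2 k a) else 0 := by
  have h := contraction_mul_apply j k Xᴴ q p
  rw [← conjTranspose_contraction, ← Matrix.conjTranspose_mul, Matrix.conjTranspose_apply] at h
  have h2 := congrArg star h
  rw [star_star, apply_ite star, star_zero, star_sum] at h2
  simpa only [Matrix.conjTranspose_apply, star_star] using h2

lemma contraction_apply (j : Fin N) (k : Fin M) (p q : BiWord d N M) :
    contraction d j k p q = if p.1 j = p.2 k then
      ∑ a, if (Function.update p.1 j a, Function.update p.2 k a) = q then 1 else 0 else 0 := by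
  have h := contraction_mul_apply j k (1 : Matrix (BiWord d N M) _ ℂ) p q
  rw [mul_one] at h
  simpa only [Matrix.one_apply] using h

lemma contraction_mul_self (j : Fin N) (k : Fin M) :
    contraction d j k * contraction d j k
      = (d : ℂ) • contraction d j k := by
  ext p q
  rw [contraction_mul_apply, Matrix.smul_apply]
  simp only [contraction_apply, Function.update_self, Function.update_idem, if_true]
  split_ifs <;> simp

/-- The exchange of the `k`-th and the `l`-th factor on the right. -/
def exchange (d N : ℕ) (k l : Fin M) :
    Matrix (BiWord d N M) (BiWord d N M) ℂ :=
  Matrix.of fun p q => if (p.1, p.2 ∘ Equiv.swap k l) = q then 1 else 0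

lemma exchange_mul_apply {ι : Type*} (k l : Fin M)
    (X : Matrix (BiWord d N M) ι ℂ) (p : BiWord d N M)
    (q : ι) : (exchange d N k l * X) p q = X (p.1, p.2 ∘ Equiv.swap k l) q := by
  simp [exchange, Matrix.mul_apply]

lemma comp_swap_comp_swap (k l : Fin M) (y : Fin M → Fin d) :
    (y ∘ Equiv.swap k l) ∘ Equiv.swap k l = y := by
  ext i; simp

lemma conjTranspose_exchange (k l : Fin M) : (exchange d N k l)ᴴ = exchange d N k l := by
  ext p q
  simp only [exchange, Matrix.conjTranspose_apply, Matrix.of_apply, Prod.ext_iff]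
  have h (y y' : Fin M → Fin d) : y ∘ Equiv.swap k l = y' ↔ y' ∘ Equiv.swap k l = y := by
    constructor <;> rintro rfl <;> exact comp_swap_comp_swap k l _
  simp only [h (q.2), eq_comm (a := q.1)]
  split_ifs <;> simp

lemma update_comp_swap {k l : Fin M} (y : Fin M → Fin d) (a : Fin d) :
    Function.update y k a ∘ Equiv.swap k l = Function.update (y ∘ Equiv.swap k l) l a := by
  ext i
  by_cases hi : i = l
  · subst hi; simp
  · have : Equiv.swap k l i ≠ k := by
      intro h; apply hi
      rw [← Equiv.swap_apply_self k l i, h, Equiv.swap_apply_left]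
    simp [hi, this]

lemma contraction_mul_exchange (j : Fin N) {k l : Fin M} (hkl : k ≠ l) :
    contraction d j k * exchange d N k l
      = contraction d j k * contraction d j l := by
  ext p q
  rw [contraction_mul_apply, contraction_mul_apply]
  congr 1
  simp only [contraction_apply, exchange, Matrix.of_apply, Function.update_self,
    Function.update_of_ne hkl.symm, Function.update_idem]
  rw [Finset.sum_ite_eq' Finset.univ]
  rw [if_pos (Finset.mem_univ _)]
  refine Finset.sum_congr rfl fun a _ => ?_
  have h : Function.update p.2 k a ∘ Equiv.swap k l
      = Function.update (Function.update p.2 k (p.2 l)) l a := by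
    ext i
    by_cases hi : i = k
    · subst hi; simp [hkl, hkl.symm]
    · by_cases hi' : i = l
      · subst hi'; simp
      · simp [hi, hi', Equiv.swap_apply_of_ne_of_ne hi hi']
  rw [h]

lemma exchange_mul_contraction_mul_exchange (j : Fin N) (k l : Fin M) :
    exchange d N k l * contraction d j k * exchange d N k l
      = contraction d j l := by
  ext p q
  rw [mul_assoc, exchange_mul_apply, contraction_mul_apply, contraction_apply]
  simp only [exchange, Matrix.of_apply, update_comp_swap, comp_swap_comp_swap, Function.comp_apply,
    Equiv.swap_apply_left]

variable [NeZero d]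

lemma contraction_nonneg (j : Fin N) (k : Fin M) :
    0 ≤ contraction d j k := by
  have hd : (d : ℂ) ≠ 0 := by exact_mod_cast NeZero.ne d
  have h : contraction d j k
      = (((d : ℝ)⁻¹ : ℝ) : ℂ) • (star (contraction d j k) * contraction d j k) := by
    rw [Matrix.star_eq_conjTranspose, conjTranspose_contraction, contraction_mul_self, smul_smul]
    simp [hd]
  rw [h]
  exact ofReal_smul_nonneg (star_mul_self_nonneg (contraction d j k)) (by positivity)

/-- The difference of the two sides is `(1 - s) C_{jk} (1 - s)`, where `s` exchanges the factors `k`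
and `l` on the right. -/
lemma contraction_mul_add_mul_le (j : Fin N) {k l : Fin M} (hkl : k ≠ l) :
    (contraction d j k * contraction d j l + contraction d j l * contraction d j k :
      Matrix (BiWord d N M) _ ℂ) ≤ contraction d j k + contraction d j l := by
  have h1 := contraction_mul_exchange (d := d) j hkl
  have h2 : exchange d N k l * contraction d j k
      = (contraction d j l * contraction d j k : Matrix (BiWord d N M) _ ℂ) := by
    have := congrArg Matrix.conjTranspose h1
    simpa only [Matrix.conjTranspose_mul, conjTranspose_contraction, conjTranspose_exchange]
      using this
  have h3 := star_left_conjugate_nonneg (contraction_nonneg (d := d) j k) (1 - exchange d N k l)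
  have h4 : star (1 - exchange d N k l : Matrix (BiWord d N M) _ ℂ)
      = 1 - exchange d N k l := by
    rw [star_sub, star_one, Matrix.star_eq_conjTranspose, conjTranspose_exchange]
  rw [← sub_nonneg]
  convert h3 using 1
  rw [h4, sub_mul, mul_sub, one_mul, mul_one, sub_mul, exchange_mul_contraction_mul_exchange, h1,
    h2]
  abel

/-- One input factor can be contracted with `M` output factors at total strength `M + d - 1`. -/
lemma sum_contraction_le (j : Fin N) (hM : 1 ≤ M) :
    (∑ k : Fin M, contraction d j k : Matrix (BiWord d N M) _ ℂ)
      ≤ (((M : ℝ) + d - 1 : ℝ) : ℂ) • 1 := by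
  have hd : (1 : ℝ) ≤ d := by exact_mod_cast Nat.pos_of_neZero d
  have hM' : (1 : ℝ) ≤ M := by exact_mod_cast hM
  set S : Matrix (BiWord d N M) _ ℂ := ∑ k : Fin M, contraction d j k with hS
  refine le_smul_one_of_mul_self_le ?_ (by linarith) ?_
  · rw [Matrix.IsHermitian, hS, Matrix.conjTranspose_sum]
    simp only [conjTranspose_contraction]
  have h1 (k l : Fin M) :
      (contraction d j k * contraction d j l + contraction d j l * contraction d j k :
      Matrix (BiWord d N M) _ ℂ) ≤ contraction d j k + contraction d j l
        + if k = l then (2 * (d : ℂ) - 2) • contraction d j k else 0 := by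
    by_cases hkl : k = l
    · subst hkl
      rw [if_pos rfl, contraction_mul_self]
      apply le_of_eq
      module
    · rw [if_neg hkl, add_zero]
      exact contraction_mul_add_mul_le j hkl
  have h2 := Finset.sum_le_sum fun k (_ : k ∈ Finset.univ) =>
    Finset.sum_le_sum fun l (_ : l ∈ Finset.univ) => h1 k l
  simp only [Finset.sum_add_distrib, ← Finset.mul_sum, ← Finset.sum_mul, Finset.sum_ite_eq,
    Finset.mem_univ, if_true, Finset.sum_const, Finset.card_univ, Fintype.card_fin,
    ← Finset.smul_sum, ← hS] at h2
  have h3 := ofReal_smul_nonneg (sub_nonneg.mpr h2) (c := 1 / 2) (by norm_num)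
  rw [← sub_nonneg]
  convert h3 using 1
  rw [← Nat.cast_smul_eq_nsmul ℂ]
  push_cast
  module

end Contraction

/-! ### The upper bound for cloning -/

section Upper

variable {d N M : ℕ}

lemma expect_reduced (ψ : Fin d → ℂ) (k : Fin M) (ρ : Op d M) :
    expect ψ (reduced k ρ) = (ρ * site k (proj ψ)).trace.re := by
  have h : star ψ ⬝ᵥ (reduced k ρ *ᵥ ψ) = (ρ * site k (proj ψ)).trace := by
    simp only [Matrix.trace, Matrix.diag, mul_site_apply, proj, Matrix.vecMulVec_apply, dotProduct,
      Matrix.mulVec, reduced, Matrix.of_apply, Finset.mul_sum, Finset.sum_mul]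
    rw [Finset.sum_congr rfl fun a _ => Finset.sum_comm, Finset.sum_comm]
    refine Finset.sum_congr rfl fun y _ => ?_
    rw [Finset.sum_comm]
    refine Finset.sum_congr rfl fun b _ => ?_
    rw [Finset.sum_eq_single (y k)]
    · simp
      ring
    · intro a _ ha
      simp [ha.symm]
    · simp
  rw [expect, h]

/-- The fidelity of a clone as a polynomial in the state, with the Choi matrix as coefficients. -/
lemma trace_map_copies_mul_site (L : CompletelyPositiveMap (Op d N) (Op d M)) (k : Fin M)
    (ψ : Fin d → ℂ) :
    (L (copies N ψ) * site k (proj ψ)).trace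
      = ∑ x, ∑ x', ∑ y : Fin M → Fin d, ∑ b, L (Matrix.single x x' 1) y (Function.update y k b)
        * copies (N + 1) ψ (Fin.cons b x) (Fin.cons (y k) x') := by
  have hL : L (copies N ψ) = ∑ x, ∑ x', copies N ψ x x' • L (Matrix.single x x' 1) := by
    conv_lhs => rw [Matrix.matrix_eq_sum_single (copies N ψ)]
    simp only [map_sum]
    refine Finset.sum_congr rfl fun x _ => Finset.sum_congr rfl fun x' _ => ?_
    rw [← map_smul, Matrix.smul_single, smul_eq_mul, mul_one]
  rw [hL]
  simp only [Finset.sum_mul, Matrix.trace_sum]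
  refine Finset.sum_congr rfl fun x _ => Finset.sum_congr rfl fun x' _ => ?_
  simp only [Matrix.trace, Matrix.diag, mul_site_apply, Matrix.smul_apply, copies_cons, proj,
    Matrix.vecMulVec_apply, smul_eq_mul, Pi.star_apply, RCLike.star_def]
  refine Finset.sum_congr rfl fun y _ => Finset.sum_congr rfl fun b _ => ?_
  ring

variable [NeZero d]

lemma integral_cloneFidelity (L : QCM d N M) (k : Fin M) :
    ∫ ψ, L.cloneFidelity k ψ ∂pureStateMeasure d
      = (∑ x, ∑ x', ∑ y : Fin M → Fin d, ∑ b,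
        L.toMap (Matrix.single x x' 1) y (Function.update y k b)
        * moment d (N + 1) (Fin.cons b x) (Fin.cons (y k) x')).re := by
  have hint (x x' : Fin N → Fin d) (y : Fin M → Fin d) (b : Fin d) : Integrable
      (fun ψ : Fin d → ℂ => L.toMap (Matrix.single x x' 1) y (Function.update y k b)
        * copies (N + 1) ψ (Fin.cons b x) (Fin.cons (y k) x')) (pureStateMeasure d) :=
    integrable_of_continuous (continuous_const.mul (continuous_copies.matrix_elem _ _))
  simp only [QCM.cloneFidelity, expect_reduced, trace_map_copies_mul_site]
  refine (integral_re (integrable_finsetSum _ fun x _ => integrable_finsetSum _ fun x' _ =>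
    integrable_finsetSum _ fun y _ => integrable_finsetSum _ fun b _ => hint x x' y b)).trans ?_
  refine congrArg Complex.re ?_
  rw [integral_finsetSum _ fun x _ => integrable_finsetSum _ fun x' _ =>
    integrable_finsetSum _ fun y _ => integrable_finsetSum _ fun b _ => hint x x' y b]
  refine Finset.sum_congr rfl fun x _ => ?_
  rw [integral_finsetSum _ fun x' _ =>
    integrable_finsetSum _ fun y _ => integrable_finsetSum _ fun b _ => hint x x' y b]
  refine Finset.sum_congr rfl fun x' _ => ?_
  rw [integral_finsetSum _ fun y _ => integrable_finsetSum _ fun b _ => hint x x' y b]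
  refine Finset.sum_congr rfl fun y _ => ?_
  rw [integral_finsetSum _ fun b _ => hint x x' y b]
  refine Finset.sum_congr rfl fun b _ => ?_
  rw [integral_const_mul, moment_apply]

open scoped Kronecker in
/-- The operator `∫ ψ^{⊗N} dψ ⊗ 1` on the input and output systems. -/
noncomputable def inputMoment (d N M : ℕ) [NeZero d] : Matrix (BiWord d N M) (BiWord d N M) ℂ :=
  moment d N ⊗ₖ 1

lemma inputMoment_apply (p q : BiWord d N M) :
    inputMoment d N M p q = if p.2 = q.2 then moment d N p.1 q.1 else 0 := by
  simp [inputMoment, Matrix.kroneckerMap_apply, Matrix.one_apply]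

lemma inputMoment_nonneg : 0 ≤ inputMoment d N M :=
  Matrix.nonneg_iff_posSemidef.mpr
    ((Matrix.nonneg_iff_posSemidef.mp moment_nonneg).kronecker Matrix.PosSemidef.one)

open scoped Kronecker in
/-- Summed over the input factors, the contractions are built from collective operators on the
input, which commute with the moment operator. -/
lemma inputMoment_commute (k : Fin M) :
    Commute (inputMoment d N M) (∑ j, contraction d j k) := by
  have h : (∑ j : Fin N, contraction d j k)
      = ∑ a, ∑ b, collective N (Matrix.single a b 1) ⊗ₖ site k (Matrix.single a b 1) := by
    simp only [contraction]
    rw [Finset.sum_comm]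
    refine Finset.sum_congr rfl fun a _ => ?_
    rw [Finset.sum_comm]
    refine Finset.sum_congr rfl fun b _ => ?_
    ext p q
    simp [collective, Matrix.sum_apply, Matrix.kroneckerMap_apply, Finset.sum_mul]
  rw [h]
  refine Commute.sum_right _ _ _ fun a _ => Commute.sum_right _ _ _ fun b _ => ?_
  rw [Commute, SemiconjBy, inputMoment, ← Matrix.mul_kronecker_mul, ← Matrix.mul_kronecker_mul,
    collective_mul_moment, one_mul, mul_one]

/-- Averaging over the state turns the fidelity of the `k`-th clone into an expectation of
contraction operators. -/
lemma integral_cloneFidelity_eq (L : QCM d N M) (k : Fin M) :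
    ((N : ℝ) + d) * ∫ ψ, L.cloneFidelity k ψ ∂pureStateMeasure d
      = 1 + (∑ p : BiWord d N M, ∑ q : BiWord d N M, L.toMap (Matrix.single p.1 q.1 1) p.2 q.2
        * (inputMoment d N M * ∑ j : Fin N, contraction d j k) p q).re := by
  set J : (Fin N → Fin d) → (Fin N → Fin d) → Op d M := fun x x' =>
    L.toMap (Matrix.single x x' 1)
  have hone : ∑ x, ∑ x', ∑ y : Fin M → Fin d, ∑ b, J x x' y (Function.update y k b)
      * (if y k = b then moment d N x x' else 0) = 1 := by
    simp only [mul_ite, mul_zero, Finset.sum_ite_eq, Finset.mem_univ, if_true,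
      Function.update_eq_self, ← Finset.sum_mul]
    have htr (x x' : Fin N → Fin d) : ∑ y, J x x' y y = if x = x' then 1 else 0 := by
      refine (L.trace_map (Matrix.single x x' 1)).trans ?_
      split_ifs with h
      · subst h; simp
      · exact Matrix.trace_single_eq_of_ne _ _ _ h
    simp only [htr, ite_mul, one_mul, zero_mul, Finset.sum_ite_eq, Finset.mem_univ, if_true]
    exact trace_moment
  have htwo : ∑ x, ∑ x', ∑ y : Fin M → Fin d, ∑ b, J x x' y (Function.update y k b)
      * (∑ j, if x' j = b then moment d N x (Function.update x' j (y k)) else 0)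
      = ∑ p : BiWord d N M, ∑ q : BiWord d N M, J p.1 q.1 p.2 q.2
        * (inputMoment d N M * ∑ j : Fin N, contraction d j k) p q := by
    simp only [Fintype.sum_prod_type, Matrix.mul_sum, Matrix.sum_apply, mul_contraction_apply,
      inputMoment_apply]
    refine Finset.sum_congr rfl fun x _ => ?_
    refine Eq.trans ?_ Finset.sum_comm
    refine Finset.sum_congr rfl fun x' _ => ?_
    refine Eq.trans ?_ Finset.sum_comm
    rw [← sum_sum_update k]
    refine Finset.sum_congr rfl fun y _ => ?_
    have h1 (y₀ : Fin M → Fin d) : J x x' y₀ y * (∑ j, if x' j = y k then ∑ a,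
          (if y₀ = Function.update y k a then moment d N x (Function.update x' j a) else 0) else 0)
        = ∑ a, if y₀ = Function.update y k a then J x x' (Function.update y k a) y *
          ∑ j, (if x' j = y k then moment d N x (Function.update x' j a) else 0) else 0 := by
      have h2 (j : Fin N) : (if x' j = y k then ∑ a,
          (if y₀ = Function.update y k a then moment d N x (Function.update x' j a) else 0) else 0)
          = ∑ a, if y₀ = Function.update y k a then
            (if x' j = y k then moment d N x (Function.update x' j a) else 0) else 0 := by
        split_ifs <;> simp
      simp only [h2]
      rw [Finset.sum_comm, Finset.mul_sum]
      refine Finset.sum_congr rfl fun a _ => ?_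
      split_ifs with h
      · rw [h]
      · simp
    simp only [h1]
    rw [Finset.sum_comm]
    refine Finset.sum_congr rfl fun a _ => ?_
    simp only [Finset.sum_ite_eq', Finset.mem_univ, if_true, Function.update_self,
      Function.update_idem, Function.update_eq_self]
  have h5 := congrArg Complex.re hone
  rw [Complex.one_re] at h5
  rw [integral_cloneFidelity, ← htwo, ← h5, ← Complex.add_re]
  have h3 : ((N : ℝ) + d) = (((N : ℝ) + d : ℝ) : ℂ).re := rfl
  rw [h3, ← Complex.re_ofReal_mul, Complex.ofReal_re]
  refine congrArg Complex.re ?_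
  simp only [← Finset.sum_add_distrib, Finset.mul_sum]
  refine Finset.sum_congr rfl fun x _ => Finset.sum_congr rfl fun x' _ =>
    Finset.sum_congr rfl fun y _ => Finset.sum_congr rfl fun b _ => ?_
  have h4 := moment_succ (y k) b x x'
  push_cast
  rw [mul_left_comm, h4, mul_add, Finset.mul_sum]

/-- The optimal single-clone fidelity. -/
noncomputable def cloningValue (d N M : ℕ) : ℝ :=
  ((M : ℝ) - N + N * ((M : ℝ) + d)) / ((M : ℝ) * ((N : ℝ) + d))

/-- No cloning machine has a fidelity above `cloningValue`. -/
theorem QCM.fidelity_le (hM : 1 ≤ M) (L : QCM d N M) : L.fidelity ≤ cloningValue d N M := by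
  have hM' : (0 : ℝ) < M := by exact_mod_cast hM
  have hNd := natCast_add_pos d N
  obtain ⟨w, hw⟩ := exists_choi L.toMap
  set A := inputMoment d N M
  set C : Matrix (BiWord d N M) (BiWord d N M) ℂ := ∑ k, ∑ j, contraction d j k with hC
  -- the expectation of an operator in the Choi state
  let φ (X : Matrix (BiWord d N M) (BiWord d N M) ℂ) : ℝ :=
    (∑ p : BiWord d N M, ∑ q : BiWord d N M,
      L.toMap (Matrix.single p.1 q.1 1) p.2 q.2 * X p q).re
  have hφ (X) : φ X = (∑ s, star (w s) ⬝ᵥ (X *ᵥ w s)).re := by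
    simp only [φ, hw, Finset.sum_mul, dotProduct, Matrix.mulVec, Finset.mul_sum]
    congr 1
    rw [Finset.sum_congr rfl fun p _ => Finset.sum_comm, Finset.sum_comm]
    refine Finset.sum_congr rfl fun s _ => Finset.sum_congr rfl fun p _ =>
      Finset.sum_congr rfl fun q _ => ?_
    simp
    ring
  have hφ_nonneg {X} (hX : 0 ≤ X) : 0 ≤ φ X := by
    rw [hφ]
    refine (Complex.nonneg_iff.mp (Finset.sum_nonneg fun s _ => ?_)).1
    exact (Matrix.nonneg_iff_posSemidef.mp hX).dotProduct_mulVec_nonneg (w s)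
  have hφ_sub (X Y) : φ (X - Y) = φ X - φ Y := by
    simp only [hφ, Matrix.sub_mulVec, dotProduct_sub, Finset.sum_sub_distrib, Complex.sub_re]
  have hφ_smul (c : ℝ) (X) : φ ((c : ℂ) • X) = c * φ X := by
    simp only [hφ, Matrix.smul_mulVec, dotProduct_smul, smul_eq_mul, ← Finset.mul_sum,
      Complex.re_ofReal_mul]
  have hφ_sum (X : Fin M → Matrix (BiWord d N M) (BiWord d N M) ℂ) :
      φ (∑ k, X k) = ∑ k, φ (X k) := by
    simp only [hφ, Matrix.sum_mulVec, dotProduct_sum]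
    rw [Finset.sum_comm, Complex.re_sum]
  have hφA : φ A = 1 := by
    have h1 : φ A = (∑ x, ∑ x', (L.toMap (Matrix.single x x' 1)).trace * moment d N x x').re := by
      simp only [φ, A, Fintype.sum_prod_type, inputMoment_apply, mul_ite, mul_zero,
        Finset.sum_ite_eq, Finset.mem_univ, if_true, Matrix.trace, Matrix.diag, Finset.sum_mul]
      congr 1
      exact Finset.sum_congr rfl fun x _ => Finset.sum_comm
    rw [h1]
    have h2 (x x' : Fin N → Fin d) : (L.toMap (Matrix.single x x' 1)).trace * moment d N x x'
        = if x = x' then moment d N x x' else 0 := by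
      rw [L.trace_map]
      split_ifs with h
      · subst h; simp
      · rw [Matrix.trace_single_eq_of_ne _ _ _ h, zero_mul]
    simp only [h2, Finset.sum_ite_eq, Finset.mem_univ, if_true]
    exact congrArg Complex.re trace_moment
  have hCle : C ≤ (((N : ℝ) * ((M : ℝ) + d - 1) : ℝ) : ℂ) • 1 := by
    rw [hC, Finset.sum_comm]
    refine (Finset.sum_le_sum fun j _ => sum_contraction_le j hM).trans_eq ?_
    rw [Finset.sum_const, Finset.card_univ, Fintype.card_fin, ← Nat.cast_smul_eq_nsmul ℂ,
      smul_smul]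
    push_cast
    rfl
  have hAC : φ (A * C) ≤ N * ((M : ℝ) + d - 1) := by
    have h1 : A * C ≤ (((N : ℝ) * ((M : ℝ) + d - 1) : ℝ) : ℂ) • A :=
      mul_le_smul_of_commute inputMoment_nonneg
        (Commute.sum_right _ _ _ fun k _ => inputMoment_commute k) hCle
    have h2 := hφ_nonneg (sub_nonneg.mpr h1)
    rw [hφ_sub, hφ_smul, hφA] at h2
    linarith
  have hF : ((N : ℝ) + d) * (M * L.fidelity) = M + φ (A * C) := by
    have h1 : M * L.fidelity = ∑ k, ∫ ψ, L.cloneFidelity k ψ ∂pureStateMeasure d := by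
      simp only [QCM.fidelity, integral_const_mul, ← Finset.mul_sum]
      field_simp
    rw [h1, Finset.mul_sum, Finset.sum_congr rfl fun k _ => integral_cloneFidelity_eq L k,
      Finset.sum_add_distrib, hC, Matrix.mul_sum, hφ_sum]
    simp [φ, A]
  rw [cloningValue, le_div_iff₀ (by positivity)]
  nlinarith

end Upper

/-! ### Adding and removing particles -/

section Append

variable {d N r : ℕ}

/-- The isometry `|u⟩ ↦ |u⟩ ⊗ |z⟩` that adds `r` particles in the basis state `z`. -/
def adjoin (N : ℕ) (z : Fin r → Fin d) : Matrix (Fin (N + r) → Fin d) (Fin N → Fin d) ℂ :=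
  Matrix.of fun x u => if x = Fin.append u z then 1 else 0

lemma conjTranspose_adjoin_mul_mul_apply (z : Fin r → Fin d) (A : Op d (N + r))
    (u u' : Fin N → Fin d) :
    ((adjoin N z)ᴴ * A * adjoin N z) u u' = A (Fin.append u z) (Fin.append u' z) := by
  simp [Matrix.mul_apply, Matrix.conjTranspose_apply, adjoin, apply_ite conj]

lemma append_eq_append_iff (u u' : Fin N → Fin d) (z z' : Fin r → Fin d) :
    Fin.append u z = Fin.append u' z' ↔ u = u' ∧ z = z' := by
  have h := (Fin.appendEquiv (α := Fin d) N r).apply_eq_iff_eq (x := (u, z)) (y := (u', z'))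
  rw [Prod.mk.injEq] at h
  exact h

lemma sum_adjoin_mul_mul_apply (A : Op d N) (u u' : Fin N → Fin d) (z z' : Fin r → Fin d) :
    (∑ w : Fin r → Fin d, adjoin N w * A * (adjoin N w)ᴴ) (Fin.append u z) (Fin.append u' z')
      = A u u' * if z = z' then 1 else 0 := by
  simp only [Matrix.sum_apply, Matrix.mul_apply, Matrix.conjTranspose_apply, adjoin,
    Matrix.of_apply, append_eq_append_iff, apply_ite star, star_one, star_zero, mul_ite, mul_one,
    mul_zero, ite_mul, one_mul, zero_mul]
  simp only [ite_and, Finset.sum_ite_eq, Finset.mem_univ, if_true]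

lemma sum_adjoin_mul_conjTranspose :
    ∑ w : Fin r → Fin d, adjoin N w * (adjoin N w)ᴴ = 1 := by
  ext x y
  obtain ⟨⟨u, z⟩, rfl⟩ := (Fin.appendEquiv N r).surjective x
  obtain ⟨⟨u', z'⟩, rfl⟩ := (Fin.appendEquiv N r).surjective y
  have h := sum_adjoin_mul_mul_apply (1 : Op d N) u u' z z'
  simp only [Matrix.mul_one] at h
  refine h.trans ?_
  rw [Matrix.one_apply, Matrix.one_apply]
  have h2 := append_eq_append_iff u u' z z'
  change _ = if Fin.append u z = Fin.append u' z' then 1 else 0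
  simp only [h2, ite_and]
  split_ifs <;> simp

lemma copies_append (ψ : Fin d → ℂ) (u u' : Fin N → Fin d) (z z' : Fin r → Fin d) :
    copies (N + r) ψ (Fin.append u z) (Fin.append u' z') = copies N ψ u u' * copies r ψ z z' := by
  simp [copies_apply, Fin.prod_univ_add]

/-- Tracing out `r` of `N + r` copies. -/
lemma sum_conjTranspose_adjoin_copies {ψ : Fin d → ℂ} (h : IsUnitVector ψ) :
    ∑ z : Fin r → Fin d, (adjoin N z)ᴴ * copies (N + r) ψ * adjoin N z = copies N ψ := by
  ext u u'
  simp only [Matrix.sum_apply, conjTranspose_adjoin_mul_mul_apply, copies_append,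
    ← Finset.mul_sum]
  have h1 : ∑ z, copies r ψ z z = 1 := trace_copies h
  rw [h1, mul_one]

lemma sum_conjTranspose_adjoin_moment [NeZero d] :
    ∑ z : Fin r → Fin d, (adjoin N z)ᴴ * moment d (N + r) * adjoin N z = moment d N := by
  ext u u'
  simp only [Matrix.sum_apply, conjTranspose_adjoin_mul_mul_apply, moment_apply]
  rw [← integral_finsetSum _ fun z _ => integrable_of_continuous
    (continuous_copies.matrix_elem _ _)]
  refine integral_congr_ae (ae_isUnitVector.mono fun ψ hψ => ?_)
  have h1 : ∑ z, copies r ψ z z = 1 := trace_copies hψ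
  simp only [copies_append, ← Finset.mul_sum, h1, mul_one]

/-- The operator `ψ^{⊗N} ⊗ 1^{⊗r}`. -/
def paddedCopies (N r : ℕ) (ψ : Fin d → ℂ) : Op d (N + r) :=
  tensorOp (Fin.append (fun _ => proj ψ) fun _ => 1)

lemma sum_adjoin_copies (ψ : Fin d → ℂ) :
    ∑ z : Fin r → Fin d, adjoin N z * copies N ψ * (adjoin N z)ᴴ = paddedCopies N r ψ := by
  ext x y
  obtain ⟨⟨u, z⟩, rfl⟩ := (Fin.appendEquiv N r).surjective x
  obtain ⟨⟨u', z'⟩, rfl⟩ := (Fin.appendEquiv N r).surjective y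
  refine (sum_adjoin_mul_mul_apply (copies N ψ) u u' z z').trans ?_
  rw [← Matrix.one_apply, ← tensorOp_one]
  simp [paddedCopies, tensorOp_apply, Fin.prod_univ_add, copies_eq_tensorOp]

lemma site_castAdd_mul_paddedCopies {ψ : Fin d → ℂ} (h : IsUnitVector ψ) (i : Fin N) :
    site (Fin.castAdd r i) (proj ψ) * paddedCopies N r ψ = paddedCopies N r ψ := by
  rw [site, paddedCopies, tensorOp_mul]
  congr 1
  ext1 j
  by_cases hj : j = Fin.castAdd r i
  · subst hj; simp [proj_mul_proj h]
  · simp [hj]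

lemma trace_paddedCopies_mul_copies {φ : Fin d → ℂ} (ψ : Fin d → ℂ) (hφ : IsUnitVector φ) :
    (paddedCopies N r ψ * copies (N + r) φ).trace = (((‖star ψ ⬝ᵥ φ‖ ^ 2) ^ N : ℝ) : ℂ) := by
  rw [paddedCopies, copies_eq_tensorOp, tensorOp_mul, trace_tensorOp, Fin.prod_univ_add]
  simp [trace_proj_mul_proj, trace_proj hφ]

lemma trace_site_natAdd_mul_paddedCopies_mul_copies {φ : Fin d → ℂ} (ψ : Fin d → ℂ)
    (hφ : IsUnitVector φ) (i : Fin r) :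
    (site (Fin.natAdd N i) (proj ψ) * paddedCopies N r ψ * copies (N + r) φ).trace
      = (((‖star ψ ⬝ᵥ φ‖ ^ 2) ^ (N + 1) : ℝ) : ℂ) := by
  rw [site, paddedCopies, copies_eq_tensorOp, tensorOp_mul, tensorOp_mul, trace_tensorOp,
    Fin.prod_univ_add, pow_succ, Complex.ofReal_mul]
  congr 1
  · have h (j : Fin N) : Fin.castAdd r j ≠ Fin.natAdd N i := by
      intro h; have := congrArg Fin.val h; simp at this; omega
    simp [h, trace_proj_mul_proj]
  · rw [Finset.prod_eq_single i]
    · simp [trace_proj_mul_proj]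
    · intro j _ hj
      simp [hj, trace_proj hφ]
    · simp

end Append

/-! ### The optimal cloning machine -/

section Cloner

variable {d N M r : ℕ}

/-- In a permutation invariant state all particles look alike. -/
lemma trace_mul_site_eq {τ : Op d M}
    (hτ : ∀ (σ : Equiv.Perm (Fin M)) (x y : Fin M → Fin d), τ (x ∘ σ) (y ∘ σ) = τ x y)
    (X : Matrix (Fin d) (Fin d) ℂ) (k l : Fin M) :
    (τ * site k X).trace = (τ * site l X).trace := by
  simp only [Matrix.trace, Matrix.diag, mul_site_apply]
  refine Fintype.sum_equiv ((Equiv.swap l k).arrowCongr (Equiv.refl (Fin d))) _ _ fun y => ?_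
  have h : (Equiv.swap l k).arrowCongr (Equiv.refl (Fin d)) y = y ∘ Equiv.swap l k := by
    ext i; simp [Equiv.arrowCongr]
  rw [h]
  refine Finset.sum_congr rfl fun a _ => ?_
  have h2 : Function.update (y ∘ Equiv.swap l k) l a
      = Function.update y k a ∘ Equiv.swap l k := by
    rw [Equiv.swap_comm, update_comp_swap]
  rw [h2, hτ]
  simp

variable [NeZero d]

lemma fidelity_eq_of_cloneFidelity (hM : 1 ≤ M) (L : QCM d N M) {f : ℝ}
    (hL : ∀ ψ, IsUnitVector ψ → ∀ k, L.cloneFidelity k ψ = f) : L.fidelity = f := by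
  have hM' : (M : ℝ) ≠ 0 := by exact_mod_cast (by omega : M ≠ 0)
  have h (k : Fin M) : ∫ ψ, (1 / (M : ℝ)) * L.cloneFidelity k ψ ∂pureStateMeasure d
      = 1 / (M : ℝ) * f := by
    rw [integral_congr_ae (g := fun _ => 1 / (M : ℝ) * f)
      (ae_isUnitVector.mono fun ψ hψ => by simp only [hL ψ hψ k])]
    simp
  rw [QCM.fidelity, Finset.sum_congr rfl fun k _ => h k]
  simp
  field_simp

/-- Discarding all but `M` copies is a universal cloning machine with fidelity `1`. -/
lemma exists_universal_of_le (hM : 1 ≤ M) (h : M ≤ N) :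
    ∃ L : QCM d N M, L.IsUniversal ∧ L.fidelity = 1 := by
  obtain ⟨r, rfl⟩ := Nat.exists_eq_add_of_le h
  let L : QCM d (M + r) M := krausQCM (fun z : Fin r → Fin d => (adjoin M z)ᴴ)
    (by simpa only [Matrix.conjTranspose_conjTranspose] using sum_adjoin_mul_conjTranspose)
  have hL {ψ : Fin d → ℂ} (hψ : IsUnitVector ψ) : L.toMap (copies (M + r) ψ) = copies M ψ := by
    rw [krausQCM_apply, ← sum_conjTranspose_adjoin_copies (N := M) (r := r) hψ]
    simp only [Matrix.conjTranspose_conjTranspose]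
  have hfid (ψ : Fin d → ℂ) (hψ : IsUnitVector ψ) (k : Fin M) : L.cloneFidelity k ψ = 1 := by
    rw [QCM.cloneFidelity, expect_reduced, hL hψ]
    have h1 : copies M ψ * site k (proj ψ) = copies M ψ := by
      rw [site, copies_eq_tensorOp, tensorOp_mul]
      congr 1
      ext1 j
      by_cases hj : j = k
      · subst hj; simp [proj_mul_proj hψ]
      · simp [hj]
    rw [h1, trace_copies hψ, Complex.one_re]
  exact ⟨L, ⟨fun ψ hψ σ x y => by rw [hL hψ, copies_comp_left], 1, hfid⟩,
    fidelity_eq_of_cloneFidelity hM L hfid⟩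

/-- The average of `ψ^{⊗N} ⊗ 1` against symmetric states, with one more projector inserted. -/
lemma trace_collective_mul_paddedCopies_mul_moment {ψ : Fin d → ℂ} (hψ : IsUnitVector ψ) :
    (collective (N + r) (proj ψ) * paddedCopies N r ψ * moment d (N + r)).trace
      = ((N * momentValue d N + r * momentValue d (N + 1) : ℝ) : ℂ) := by
  have h1 (i : Fin N) : (site (Fin.castAdd r i) (proj ψ) * paddedCopies N r ψ
      * moment d (N + r)).trace = momentValue d N := by
    rw [site_castAdd_mul_paddedCopies hψ, trace_mul_moment, ← integral_overlap_pow hψ,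
      ← integral_complex_ofReal]
    exact integral_congr_ae (ae_isUnitVector.mono fun φ hφ => trace_paddedCopies_mul_copies ψ hφ)
  have h2 (i : Fin r) : (site (Fin.natAdd N i) (proj ψ) * paddedCopies N r ψ
      * moment d (N + r)).trace = momentValue d (N + 1) := by
    rw [trace_mul_moment, ← integral_overlap_pow hψ, ← integral_complex_ofReal]
    exact integral_congr_ae (ae_isUnitVector.mono fun φ hφ =>
      trace_site_natAdd_mul_paddedCopies_mul_copies ψ hφ i)
  simp only [collective, Fin.sum_univ_add, add_mul, Finset.sum_mul, Matrix.trace_add,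
    Matrix.trace_sum, h1, h2]
  simp

/-- The optimal cloning machine: on the symmetric subspace it maps `ρ` to a multiple of
`P (ρ ⊗ 1) P`, where `P` is the projector onto the symmetric subspace of `M` particles; the input
outside of the symmetric subspace is replaced by a fixed state. -/
lemma exists_universal_cloningValue (hM : 1 ≤ M) (h : N ≤ M) :
    ∃ L : QCM d N M, L.IsUniversal ∧ L.fidelity = cloningValue d N M := by
  obtain ⟨r, rfl⟩ := Nat.exists_eq_add_of_le h
  have hm := momentValue_pos d N
  have hm' := momentValue_pos d (N + r)
  have hmc : (momentValue d N : ℂ) ≠ 0 := by exact_mod_cast hm.ne'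
  have hmc' : (momentValue d (N + r) : ℂ) ≠ 0 := by exact_mod_cast hm'.ne'
  set s : ℝ := (Real.sqrt (momentValue d (N + r) * momentValue d N))⁻¹ with hs
  have hss : (s : ℂ) * s = ((momentValue d (N + r) : ℂ) * momentValue d N)⁻¹ := by
    rw [← Complex.ofReal_mul, hs, ← mul_inv, Real.mul_self_sqrt (by positivity)]
    push_cast
    rfl
  -- the projector onto the complement of the symmetric subspace of the input
  set Q : Op d N := 1 - (momentValue d N : ℂ)⁻¹ • moment d N with hQ
  have hQh : Qᴴ = Q := by
    rw [hQ, Matrix.conjTranspose_sub, Matrix.conjTranspose_smul, moment_isHermitian.eq]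
    simp
  have hQQ : Q * Q = Q := by
    have h1 : moment d N * Q = 0 := by
      rw [hQ, mul_sub, mul_smul_comm, moment_mul_moment, smul_smul, inv_mul_cancel₀ hmc, mul_one,
        one_smul, sub_self]
    nth_rewrite 1 [hQ]
    rw [sub_mul, one_mul, smul_mul_assoc, h1, smul_zero, sub_zero]
  let e (b : Fin N → Fin d) : Matrix (Fin (N + r) → Fin d) (Fin N → Fin d) ℂ :=
    Matrix.single 0 b 1
  have he (b : Fin N → Fin d) : (e b)ᴴ * e b = Matrix.single b b 1 := by
    rw [Matrix.conjTranspose_single, star_one, Matrix.single_mul_single_same, one_mul]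
  let K : (Fin r → Fin d) ⊕ (Fin N → Fin d) → Matrix (Fin (N + r) → Fin d) (Fin N → Fin d) ℂ :=
    Sum.elim (fun z => (s : ℂ) • (moment d (N + r) * adjoin N z))
      fun b => e b * Q
  have hK : ∑ k, (K k)ᴴ * K k = 1 := by
    have h1 (z : Fin r → Fin d) : ((s : ℂ) • (moment d (N + r) * adjoin N z))ᴴ
          * ((s : ℂ) • (moment d (N + r) * adjoin N z))
        = (momentValue d N : ℂ)⁻¹ • ((adjoin N z)ᴴ * moment d (N + r) * adjoin N z) := by
      rw [Matrix.conjTranspose_smul, Matrix.conjTranspose_mul, moment_isHermitian.eq,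
        Matrix.smul_mul, Matrix.mul_smul, smul_smul, Matrix.mul_assoc,
        ← Matrix.mul_assoc (moment d (N + r)), moment_mul_moment, Matrix.smul_mul, Matrix.mul_smul,
        smul_smul, ← Matrix.mul_assoc]
      congr 1
      rw [RCLike.star_def, Complex.conj_ofReal, hss]
      field_simp
    have h2 (b : Fin N → Fin d) : (e b * Q)ᴴ * (e b * Q) = Q * Matrix.single b b 1 * Q := by
      rw [Matrix.conjTranspose_mul, hQh, Matrix.mul_assoc, ← Matrix.mul_assoc (e b)ᴴ, he,
        ← Matrix.mul_assoc]
    have h3 : ∑ b : Fin N → Fin d, Matrix.single b b (1 : ℂ) = 1 := by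
      ext x y
      simp [Matrix.sum_apply, Matrix.single_apply, Matrix.one_apply, ite_and]
    rw [Fintype.sum_sum_type]
    simp only [K, Sum.elim_inl, Sum.elim_inr, h1, h2, ← Finset.smul_sum, ← Finset.sum_mul,
      ← Finset.mul_sum, sum_conjTranspose_adjoin_moment, h3]
    rw [mul_one, hQQ, hQ, add_sub_cancel]
  have hL (ψ : Fin d → ℂ) : (krausQCM K hK).toMap (copies N ψ)
      = ((momentValue d (N + r) : ℂ) * momentValue d N)⁻¹ •
        (moment d (N + r) * paddedCopies N r ψ * moment d (N + r)) := by
    have hQψ : Q * copies N ψ = 0 := by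
      rw [hQ, sub_mul, one_mul, smul_mul_assoc, moment_mul (copies_comp_left ψ), smul_smul,
        inv_mul_cancel₀ hmc, one_smul, sub_self]
    have h1 (z : Fin r → Fin d) : ((s : ℂ) • (moment d (N + r) * adjoin N z)) * copies N ψ
          * ((s : ℂ) • (moment d (N + r) * adjoin N z))ᴴ
        = ((momentValue d (N + r) : ℂ) * momentValue d N)⁻¹ • (moment d (N + r) *
          (adjoin N z * copies N ψ * (adjoin N z)ᴴ) * moment d (N + r)) := by
      rw [Matrix.conjTranspose_smul, Matrix.conjTranspose_mul, moment_isHermitian.eq,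
        Matrix.smul_mul, Matrix.smul_mul, Matrix.mul_smul, smul_smul, RCLike.star_def,
        Complex.conj_ofReal, hss]
      simp only [Matrix.mul_assoc]
    have h2 (b : Fin N → Fin d) : e b * Q * copies N ψ * (e b * Q)ᴴ = 0 := by
      rw [Matrix.mul_assoc (e b), hQψ, Matrix.mul_zero, Matrix.zero_mul]
    rw [krausQCM_apply, Fintype.sum_sum_type]
    simp only [K, Sum.elim_inl, Sum.elim_inr, h1, h2, ← Finset.smul_sum, ← Finset.sum_mul,
      ← Finset.mul_sum, sum_adjoin_copies, Finset.sum_const_zero, add_zero]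
  have hfid (ψ : Fin d → ℂ) (hψ : IsUnitVector ψ) (k : Fin (N + r)) :
      (krausQCM K hK).cloneFidelity k ψ = cloningValue d N (N + r) := by
    set τ := (krausQCM K hK).toMap (copies N ψ) with hτ
    have hsymm (l : Fin (N + r)) : (τ * site l (proj ψ)).trace = (τ * site k (proj ψ)).trace := by
      refine trace_mul_site_eq (fun σ x y => ?_) _ _ _
      rw [hτ, hL, mul_assoc]
      simp only [Matrix.smul_apply, Matrix.mul_apply, moment_comp_left, moment_comp_right]
    have hsum : (((N + r : ℕ) : ℂ)) * (τ * site k (proj ψ)).trace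
        = (momentValue d N : ℂ)⁻¹ *
          ((N * momentValue d N + r * momentValue d (N + 1) : ℝ) : ℂ) := by
      have h1 : (((N + r : ℕ) : ℂ)) * (τ * site k (proj ψ)).trace
          = (τ * collective (N + r) (proj ψ)).trace := by
        simp only [collective, Finset.mul_sum, Matrix.trace_sum, hsymm]
        simp
      have h2 : (moment d (N + r) * paddedCopies N r ψ * moment d (N + r)
            * collective (N + r) (proj ψ)).trace
          = (momentValue d (N + r) : ℂ) * (collective (N + r) (proj ψ) * paddedCopies N r ψ
            * moment d (N + r)).trace := by
        rw [mul_assoc, ← collective_mul_moment, mul_assoc, Matrix.trace_mul_comm, mul_assoc,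
          mul_assoc, moment_mul_moment, mul_smul_comm, mul_smul_comm, Matrix.trace_smul,
          smul_eq_mul, collective_mul_moment, ← mul_assoc, Matrix.trace_mul_comm, ← mul_assoc]
      rw [h1, hτ, hL, smul_mul_assoc, Matrix.trace_smul, h2,
        trace_collective_mul_paddedCopies_mul_moment hψ, smul_eq_mul]
      field_simp
    have hre := congrArg Complex.re hsum
    rw [← Complex.ofReal_inv, Complex.re_ofReal_mul, Complex.ofReal_re, ← Complex.ofReal_natCast,
      Complex.re_ofReal_mul] at hre
    have hpos := natCast_add_pos d N
    have hM' : (0 : ℝ) < (N + r : ℕ) := by exact_mod_cast hM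
    rw [QCM.cloneFidelity, expect_reduced, cloningValue, eq_div_iff (by positivity)]
    rw [momentValue_succ] at hre
    field_simp at hre
    push_cast at hre ⊢
    linear_combination hre
  refine ⟨krausQCM K hK, ⟨fun ψ _ σ x y => ?_, _, hfid⟩,
    fidelity_eq_of_cloneFidelity hM _ hfid⟩
  rw [hL, mul_assoc]
  simp only [Matrix.smul_apply, Matrix.mul_apply, moment_comp_left]

end Cloner

/-! ### Optimal values -/

section Optimal

variable {d : ℕ} [NeZero d] {N M : ℕ}

lemma fidelity_le_optQCM (hM : 1 ≤ M) (L : QCM d N M) : L.fidelity ≤ optQCM d N M :=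
  le_csSup ⟨cloningValue d N M, by rintro _ ⟨L, rfl⟩; exact L.fidelity_le hM⟩ ⟨L, rfl⟩

lemma fidelity_le_optUQCM (hM : 1 ≤ M) {L : QCM d N M} (hL : L.IsUniversal) :
    L.fidelity ≤ optUQCM d N M :=
  le_csSup ⟨cloningValue d N M, by rintro _ ⟨L, -, rfl⟩; exact L.fidelity_le hM⟩ ⟨L, hL, rfl⟩

lemma optUQCM_le_optQCM (hM : 1 ≤ M) (h : ∃ L : QCM d N M, L.IsUniversal) :
    optUQCM d N M ≤ optQCM d N M := by
  obtain ⟨L, hL⟩ := h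
  refine csSup_le ⟨_, L, hL, rfl⟩ ?_
  rintro _ ⟨L, -, rfl⟩
  exact fidelity_le_optQCM hM L

lemma optQCM_le (hM : 1 ≤ M) (h : Nonempty (QCM d N M)) : optQCM d N M ≤ cloningValue d N M := by
  obtain ⟨L⟩ := h
  refine csSup_le ⟨_, L, rfl⟩ ?_
  rintro _ ⟨L, rfl⟩
  exact L.fidelity_le hM

/-- The margin of cloning over estimation. -/
lemma cloningValue_eq (hM : 1 ≤ M) : cloningValue d N M
    = ((N : ℝ) + 1) / (N + d) + N * ((d : ℝ) - 1) / (M * (N + d)) := by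
  have hM' : (M : ℝ) ≠ 0 := by exact_mod_cast (by omega : M ≠ 0)
  have hpos := (natCast_add_pos d N).ne'
  rw [cloningValue]
  field_simp
  ring

end Optimal

end QuantumCloning

theorem theorem2 (d N M : ℕ) [NeZero d] (hN : 1 ≤ N) (hM : 1 ≤ M) :
    -- optimal cloning is at least as good as optimal challenge estimation
    QuantumCloning.optEst d N ≤ QuantumCloning.optQCM d N M ∧
    QuantumCloning.optEst d N ≤ QuantumCloning.optUQCM d N M ∧
    -- and strictly better in dimension greater than one
    (1 < d → QuantumCloning.optEst d N < QuantumCloning.optQCM d N M ∧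
      QuantumCloning.optEst d N < QuantumCloning.optUQCM d N M) ∧
    -- the explicit formulas for the optimal values
    QuantumCloning.optEst d N = ((N : ℝ) + 1) / ((N : ℝ) + d) ∧
    (N ≤ M →
      QuantumCloning.optQCM d N M
        = ((M : ℝ) - N + N * ((M : ℝ) + d)) / ((M : ℝ) * ((N : ℝ) + d)) ∧
      QuantumCloning.optUQCM d N M
        = ((M : ℝ) - N + N * ((M : ℝ) + d)) / ((M : ℝ) * ((N : ℝ) + d))) ∧
    -- and the strict comparison of the formulas
    (1 < d →
      ((M : ℝ) - N + N * ((M : ℝ) + d)) / ((M : ℝ) * ((N : ℝ) + d))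
        > ((N : ℝ) + 1) / ((N : ℝ) + d)) := by
  have hpos := QuantumCloning.natCast_add_pos d N
  have hN' : (0 : ℝ) < N := by exact_mod_cast hN
  have hM' : (0 : ℝ) < M := by exact_mod_cast hM
  have hd : (1 : ℝ) ≤ d := by exact_mod_cast Nat.pos_of_neZero d
  have hle : ((N : ℝ) + 1) / (N + d) ≤ QuantumCloning.cloningValue d N M := by
    rw [QuantumCloning.cloningValue_eq hM]
    have : 0 ≤ (N : ℝ) * ((d : ℝ) - 1) / (M * (N + d)) :=
      div_nonneg (mul_nonneg hN'.le (by linarith)) (by positivity)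
    linarith
  have hlt (h : 1 < d) : ((N : ℝ) + 1) / (N + d) < QuantumCloning.cloningValue d N M := by
    have h1 : (1 : ℝ) < d := by exact_mod_cast h
    rw [QuantumCloning.cloningValue_eq hM]
    have : 0 < (N : ℝ) * ((d : ℝ) - 1) / (M * (N + d)) :=
      div_pos (mul_pos hN' (by linarith)) (by positivity)
    linarith
  -- for `M < N` the value of the formula is at least `1`, and discarding particles is optimal
  obtain ⟨L, hL, hLle, hLlt⟩ : ∃ L : QuantumCloning.QCM d N M, L.IsUniversal ∧
      ((N : ℝ) + 1) / (N + d) ≤ L.fidelity ∧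
      (1 < d → ((N : ℝ) + 1) / (N + d) < L.fidelity) := by
    rcases le_total N M with h | h
    · obtain ⟨L, hL, hf⟩ := QuantumCloning.exists_universal_cloningValue (d := d) hM h
      exact ⟨L, hL, hf ▸ hle, hf ▸ hlt⟩
    · obtain ⟨L, hL, hf⟩ := QuantumCloning.exists_universal_of_le (d := d) hM h
      refine ⟨L, hL, ?_, fun h1 => ?_⟩
      · rw [hf, div_le_one hpos]; linarith
      · have h2 : (1 : ℝ) < d := by exact_mod_cast h1
        rw [hf, div_lt_one hpos]; linarith
  have hU := QuantumCloning.fidelity_le_optUQCM hM hL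
  have hUQ := QuantumCloning.optUQCM_le_optQCM hM ⟨L, hL⟩
  rw [QuantumCloning.optEst_eq]
  refine ⟨hLle.trans (hU.trans hUQ), hLle.trans hU,
    fun h => ⟨(hLlt h).trans_le (hU.trans hUQ), (hLlt h).trans_le hU⟩, rfl, fun h => ?_, hlt⟩
  obtain ⟨L', hL', hf⟩ := QuantumCloning.exists_universal_cloningValue (d := d) hM h
  have h1 := QuantumCloning.fidelity_le_optUQCM hM hL'
  have h2 := QuantumCloning.optQCM_le hM ⟨L'⟩
  rw [hf] at h1
  exact ⟨h2.antisymm (h1.trans hUQ), (hUQ.trans h2).antisymm h1⟩
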